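/- Let $\mathcal H_F$ be the fermionic Fock space over $\mathbb C$ with its basis of semi-infinite monomials, indexed by the sets $S\subset\mathbb Z$ that differ from $\{k<0\}$ by finitely many elements, on which the fermions $\psi_k$ and $\psi^*_k$ ($k\in\mathbb Z$), satisfying $[\psi_m,\psi_n]_+=[\psi^*_m,\psi^*_n]_+=0$ and $[\psi_m,\psi^*_n]_+=\delta_{mn}$, act by adding, respectively removing, $k$ (up to sign). The vacuum $|n\rangle$ corresponds to $\{k<n\}$, so that $\psi_n|n\rangle=|n+1\rangle$, $\psi_m|n\rangle=0$ for $m<n$ and $\psi^*_m|n\rangle=0$ for $m\ge n$; $\langle n|$ is the dual vacuum. Put $\psi(z)=\sum_k\psi_kz^k$ and $\psi^*(z)=\sum_k\psi^*_kz^{-k}$, where $z$ is a formal variable. Let $J_k=\sum_{j\in\mathbb Z}:\!\psi_j\psi^*_{j+k}\!:$, with normal ordering with respect to $|0\rangle$, let $Q=J_0$ be the charge operator and $e^{\pm P}$ the shift operators ($S\mapsto S\pm1$ on basis states, so $e^{\pm P}|n\rangle=|n\pm1\rangle$). Put $J_+(\mathbf t)=\sum_{k\ge1}t_kJ_k$ and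 $J_\pm([x])=\sum_{k\ge1}\frac{x^k}{k}J_{\pm k}$. Let $\mathcal H_B=\mathbb C[w,w^{-1},t_1,t_2,\dots]$, and for $|U\rangle\in\mathcal H_F$ let $$\Phi(|U\rangle)=\sum_{l\in\mathbb Z}w^l\langle l|e^{J_+(\mathbf t)}|U\rangle .$$ Then this sum is finite, its coefficients are polynomials in the $t_k$ (so $\Phi$ maps $\mathcal H_F$ to $\mathcal H_B$), and for all $|U\rangle\in\mathcal H_F$ the following hold. 1. Currents: $\Phi(J_k|U\rangle)=\partial_{t_k}\Phi(|U\rangle)$ for $k>0$, $\Phi(J_0|U\rangle)=w\,\partial_w\Phi(|U\rangle)$, and $\Phi(J_k|U\rangle)=-k\,t_{-k}\,\Phi(|U\rangle)$ for $k<0$. 2. Vertex operators: as identities of formal series in $z$ with coefficients in $\mathcal H_B$, $$\Phi(\psi(z)|U\rangle)=X(z)\Phi(|U\rangle),\qquad \Phi(\psi^*(z)|U\rangle)=X^*(z)\Phi(|U\rangle),$$ where, with $\xi(\mathbf t,z)=\sum_{j\ge1}t_jz^j$, $\xi(\tilde\partial,z^{-1})=\sum_{j\ge1}\frac{z^{-j}}{j}\partial_{t_j}$,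 $e^{\pm P}f(w)=w^{\pm1}f(w)$ and $z^{\pm Q}f(w)=f(z^{\pm1}w)$, $$X(z)=e^{\xi(\mathbf t,z)}e^{-\xi(\tilde\partial,z^{-1})}e^Pz^Q,\qquad X^*(z)=e^{-\xi(\mathbf t,z)}e^{\xi(\tilde\partial,z^{-1})}z^{-Q}e^{-P},$$ and these products are well defined on $\mathcal H_B$: applied to any element, every coefficient of every power of $z$ is a finite sum. 3. Bosonization: as formal series in $z$ of operators on $\mathcal H_F$, $$\psi(z)=e^{J_-([z])}\,e^Pz^Q\,e^{-J_+([z^{-1}])},\qquad \psi^*(z)=e^{-J_-([z])}\,z^{-Q}e^{-P}\,e^{J_+([z^{-1}])},$$ where the products are well defined in the same sense. 4. Left vacua: for every $n\in\mathbb Z$, $$\langle n|\psi(z)=z^{n-1}\langle n-1|e^{-J_+([z^{-1}])},\qquad \langle n|\psi^*(z)=z^{-n}\langle n+1|e^{J_+([z^{-1}])}.$$ -/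

import Mathlib

noncomputable section

namespace BosonFermion

open scoped Nat

/-! ### Formal series -/

section Formal

/-- `exp f = ∑ fⁿ / n!` for a formal power series `f` without constant term, with coefficients in a
not necessarily commutative algebra. Powers `n > |d|` do not contribute to the coefficient at `d`. -/
def formalExp {σ A : Type*} [Ring A] [Algebra ℂ A] (f : MvPowerSeries σ A) : MvPowerSeries σ A :=
  fun d => ∑ n ∈ Finset.range (d.degree + 1), ((n ! : ℂ)⁻¹) • MvPowerSeries.coeff d (f ^ n)

/-- `ξ(a, x) = ∑_{k ≥ 1} a_k x ^ k`. -/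
def xi {A : Type*} [Ring A] (a : ℕ+ → A) : PowerSeries A :=
  PowerSeries.mk fun n => if h : 0 < n then a ⟨n, h⟩ else 0

/-- The series `f(z)`, as a formal distribution `∑_{m ∈ ℤ} f_m z ^ m`. -/
def atZ {A : Type*} [Ring A] (f : PowerSeries A) (m : ℤ) : A :=
  if 0 ≤ m then PowerSeries.coeff m.toNat f else 0

/-- The series `f(z⁻¹)`, as a formal distribution `∑_{m ∈ ℤ} f_m z ^ m`. -/
def atZInv {A : Type*} [Ring A] (f : PowerSeries A) (m : ℤ) : A :=
  atZ f (-m)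

variable {V : Type*} [AddCommGroup V] [Module ℂ V]

/-- The action of a formal distribution of operators `A(z) = ∑ A_a z ^ a` on a formal distribution
of vectors `u(z) = ∑ u_b z ^ b`: the coefficient of `z ^ m` is `∑_a A_a u_{m - a}`. It is meaningful
if `Composable A u` holds. -/
def act (A : ℤ → Module.End ℂ V) (u : ℤ → V) (m : ℤ) : V :=
  ∑ᶠ a : ℤ, A a (u (m - a))

/-- All the sums in `A(z) u(z)` are finite. -/
def Composable (A : ℤ → Module.End ℂ V) (u : ℤ → V) : Prop :=
  ∀ m : ℤ, (Function.support fun a : ℤ => A a (u (m - a))).Finite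

/-- A vector, as a constant series in `z`. -/
def const (v : V) : ℤ → V := Pi.single 0 v

/-- `A(z) B(z) C(z) v`. -/
def prod₃ (A B C : ℤ → Module.End ℂ V) (v : V) : ℤ → V :=
  act A (act B (act C (const v)))

/-- `A(z) B(z) C(z) v` is well defined for every `v`. -/
def WellDefined₃ (A B C : ℤ → Module.End ℂ V) : Prop :=
  ∀ v : V, Composable C (const v) ∧ Composable B (act C (const v)) ∧
    Composable A (act B (act C (const v)))

end Formal

/-! ### The fermionic Fock space -/

/-- Sets of integers that contain all sufficiently small integers and no sufficiently large ones
(equivalently, that differ from `{k | k < 0}` by a finite set). They index the basis states. -/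
def Maya : Type := {S : Set ℤ // ∃ a b : ℤ, Set.Iio a ⊆ S ∧ S ⊆ Set.Iio b}

namespace Maya

/-- `{k | k < n}`. -/
def vac (n : ℤ) : Maya := ⟨Set.Iio n, n, n, subset_rfl, subset_rfl⟩

def insert (k : ℤ) (S : Maya) : Maya :=
  ⟨Insert.insert k S.1, by
    obtain ⟨a, b, ha, hb⟩ := S.2
    refine ⟨a, max b (k + 1), fun x hx => Or.inr (ha hx), ?_⟩
    rintro x (rfl | hx)
    · simp
    · have := hb hx
      simp only [Set.mem_Iio] at this ⊢; omega⟩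

def erase (k : ℤ) (S : Maya) : Maya :=
  ⟨S.1 \ {k}, by
    obtain ⟨a, b, ha, hb⟩ := S.2
    refine ⟨min a k, b, fun x hx => ?_, fun x hx => hb hx.1⟩
    rw [Set.mem_Iio, lt_min_iff] at hx
    exact ⟨ha hx.1, ne_of_lt hx.2⟩⟩

/-- `S + n`. -/
def shift (n : ℤ) (S : Maya) : Maya :=
  ⟨{j | j - n ∈ S.1}, by
    obtain ⟨a, b, ha, hb⟩ := S.2
    refine ⟨a + n, b + n, fun x hx => ha ?_, fun x hx => ?_⟩
    · simp only [Set.mem_Iio] at hx ⊢; omega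
    · have := hb hx
      simp only [Set.mem_Iio] at this ⊢; omega⟩

/-- The charge with respect to the vacuum `{k | k < 0}`. -/
def charge (S : Maya) : ℤ :=
  ((S.1 ∩ Set.Ici 0).ncard : ℤ) - ((Set.Iio 0 \ S.1).ncard : ℤ)

/-- The number of elements of `S` that are greater than `k`. -/
def above (k : ℤ) (S : Maya) : ℕ := (S.1 ∩ Set.Ioi k).ncard

end Maya

/-- The fermionic Fock space `H_F`, with basis the semi-infinite monomials
`ψ_{s₁} ψ_{s₂} ψ_{s₃} ⋯` for `S = {s₁ > s₂ > s₃ > ⋯}` in `Maya`. -/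
abbrev Fock : Type := Maya →₀ ℂ

/-- The basis state of `S`. -/
def ket (S : Maya) : Fock := Finsupp.single S 1

/-- The dual vacuum `⟨n|`, the functional dual to the basis state `|n⟩ = ket (Maya.vac n)`. -/
def bra (n : ℤ) : Fock →ₗ[ℂ] ℂ := Finsupp.lapply (Maya.vac n)

/-- The linear operator on `H_F` with prescribed values on the basis states. -/
def ofBasis (f : Maya → Fock) : Module.End ℂ Fock := Finsupp.linearCombination ℂ f

open Classical in
/-- The fermion `ψ_k`: it adds `k` to `S`, with the sign from moving `ψ_k` to its place. -/
def psi (k : ℤ) : Module.End ℂ Fock :=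
  ofBasis fun S => if k ∈ S.1 then 0 else ((-1 : ℂ) ^ S.above k) • ket (S.insert k)

open Classical in
/-- The fermion `ψ*_k`: it removes `k` from `S`, with the sign from moving `ψ_k` to the front. -/
def psiStar (k : ℤ) : Module.End ℂ Fock :=
  ofBasis fun S => if k ∈ S.1 then ((-1 : ℂ) ^ S.above k) • ket (S.erase k) else 0

/-- `ψ(z) U = ∑_k ψ_k U z ^ k`. -/
def psiField (U : Fock) (m : ℤ) : Fock := psi m U

/-- `ψ*(z) U = ∑_k ψ*_k U z ^ (-k)`. -/
def psiStarField (U : Fock) (m : ℤ) : Fock := psiStar (-m) U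

/-- The normally ordered product of `ψ_j` and `ψ*_l` with respect to `|0⟩`: the factors are
exchanged, with a sign, when `ψ_j` is an annihilation operator (`j < 0`) and `ψ*_l` a creation
operator (`l < 0`). -/
def normalOrdered (j l : ℤ) : Module.End ℂ Fock :=
  if j < 0 ∧ l < 0 then -(psiStar l * psi j) else psi j * psiStar l

theorem psi_ket_of_mem {k : ℤ} {S : Maya} (h : k ∈ S.1) : psi k (ket S) = 0 := by
  simp [psi, ofBasis, ket, h]

theorem psiStar_ket_of_notMem {k : ℤ} {S : Maya} (h : k ∉ S.1) : psiStar k (ket S) = 0 := by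
  simp [psiStar, ofBasis, ket, h]

theorem psi_psiStar_ket_of_mem {j l : ℤ} {S : Maya} (h : j ∈ S.1) (hjl : j ≠ l) :
    psi j (psiStar l (ket S)) = 0 := by
  by_cases hl : l ∈ S.1
  · have : psiStar l (ket S) = ((-1 : ℂ) ^ S.above l) • ket (S.erase l) := by
      simp [psiStar, ofBasis, ket, hl]
    rw [this, map_smul, psi_ket_of_mem (S := S.erase l) ⟨h, hjl⟩, smul_zero]
  · rw [psiStar_ket_of_notMem hl, map_zero]

theorem psiStar_psi_ket_of_notMem {j l : ℤ} {S : Maya} (h : l ∉ S.1) (hjl : l ≠ j) :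
    psiStar l (psi j (ket S)) = 0 := by
  by_cases hj : j ∈ S.1
  · rw [psi_ket_of_mem hj, map_zero]
  · have : psi j (ket S) = ((-1 : ℂ) ^ S.above j) • ket (S.insert j) := by
      simp [psi, ofBasis, ket, hj]
    rw [this, map_smul, psiStar_ket_of_notMem (S := S.insert j), smul_zero]
    rintro (h' | h')
    · exact hjl h'
    · exact h h'

/-- On each state only finitely many terms of the current are non-zero. -/
theorem normalOrdered_support_finite (k : ℤ) (U : Fock) :
    (Function.support fun j : ℤ => normalOrdered j (j + k) U).Finite := by
  induction U using Finsupp.induction_linear with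
  | zero => simp
  | add U V hU hV =>
    simp only [map_add]
    exact (hU.union hV).subset (Function.support_add _ _)
  | single S c =>
    obtain ⟨a, b, ha, hb⟩ := S.2
    refine (Set.finite_Icc (min (min a 0) (a - k)) (max (max b 0) (b - k))).subset ?_
    intro j hj
    by_contra hout
    apply hj
    have hs : (Finsupp.single S c : Fock) = c • ket S := by simp [ket]
    have hlow : j < a → j ∈ S.1 := fun h => ha h
    have hlow' : j + k < a → j + k ∈ S.1 := fun h => ha h
    have hup : b ≤ j → j ∉ S.1 := fun h h' => absurd (hb h') (not_lt.mpr h)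
    have hup' : b ≤ j + k → j + k ∉ S.1 := fun h h' => absurd (hb h') (not_lt.mpr h)
    simp only [Set.mem_Icc, not_and_or, not_le] at hout
    simp only [hs, map_smul]
    suffices h : normalOrdered j (j + k) (ket S) = 0 by rw [h, smul_zero]
    unfold normalOrdered
    split_ifs with hc
    · simp only [LinearMap.neg_apply, Module.End.mul_apply, neg_eq_zero]
      rcases hout with hout | hout
      · rw [psi_ket_of_mem (hlow (by omega)), map_zero]
      · omega
    · simp only [Module.End.mul_apply]
      rcases hout with hout | hout
      · rcases eq_or_ne k 0 with rfl | hk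
        · omega
        · exact psi_psiStar_ket_of_mem (hlow (by omega)) (by omega)
      · rw [psiStar_ket_of_notMem (hup' (by omega)), map_zero]

/-- The current component `J_k`, the sum over `j` of the normally ordered `ψ_j ψ*_{j+k}`. -/
def J (k : ℤ) : Module.End ℂ Fock where
  toFun U := ∑ᶠ j : ℤ, normalOrdered j (j + k) U
  map_add' U V := by
    simp only [map_add]
    exact finsum_add_distrib (normalOrdered_support_finite k U) (normalOrdered_support_finite k V)
  map_smul' c U := by
    simp only [map_smul, RingHom.id_apply]
    rw [smul_finsum' _ (normalOrdered_support_finite k U)]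

/-- The charge operator `Q = J_0` has eigenvalue `S.charge` on the basis state of `S`. -/
theorem J_zero_ket (S : Maya) : J 0 (ket S) = (S.charge : ℂ) • ket S := by
  classical
  have hins : ∀ j, j ∉ S.1 → psiStar j (psi j (ket S)) = ket S := by
    intro j hj
    have h1 : psi j (ket S) = ((-1 : ℂ) ^ S.above j) • ket (S.insert j) := by
      simp [psi, ofBasis, ket, hj]
    have hmem : j ∈ (S.insert j).1 := Or.inl rfl
    have h2 : psiStar j (ket (S.insert j)) =
        ((-1 : ℂ) ^ (S.insert j).above j) • ket ((S.insert j).erase j) := by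
      simp [psiStar, ofBasis, ket, hmem]
    have h3 : (S.insert j).erase j = S := Subtype.ext (Set.insert_sdiff_self_of_notMem hj)
    have h4 : (S.insert j).above j = S.above j := by
      unfold Maya.above Maya.insert
      congr 1
      ext x
      simp only [Set.mem_inter_iff, Set.mem_insert_iff, Set.mem_Ioi]
      constructor
      · rintro ⟨rfl | h, h'⟩
        · exact absurd h' (lt_irrefl _)
        · exact ⟨h, h'⟩
      · exact fun h => ⟨Or.inr h.1, h.2⟩
    rw [h1, map_smul, h2, h3, h4, smul_smul, ← mul_pow]
    simp
  have hera : ∀ j, j ∈ S.1 → psi j (psiStar j (ket S)) = ket S := by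
    intro j hj
    have h1 : psiStar j (ket S) = ((-1 : ℂ) ^ S.above j) • ket (S.erase j) := by
      simp [psiStar, ofBasis, ket, hj]
    have hmem : j ∉ (S.erase j).1 := fun h => h.2 rfl
    have h2 : psi j (ket (S.erase j)) =
        ((-1 : ℂ) ^ (S.erase j).above j) • ket ((S.erase j).insert j) := by
      simp [psi, ofBasis, ket, hmem]
    have h3 : (S.erase j).insert j = S :=
      Subtype.ext (by simp [Maya.erase, Maya.insert, Set.insert_eq_of_mem hj])
    have h4 : (S.erase j).above j = S.above j := by
      unfold Maya.above Maya.erase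
      congr 1
      ext x
      simp only [Set.mem_inter_iff, Set.mem_sdiff, Set.mem_singleton_iff, Set.mem_Ioi]
      exact ⟨fun h => ⟨h.1.1, h.2⟩, fun h => ⟨⟨h.1, h.2.ne'⟩, h.2⟩⟩
    rw [h1, map_smul, h2, h3, h4, smul_smul, ← mul_pow]
    simp
  obtain ⟨a, b, ha, hb⟩ := S.2
  have hf1 : (S.1 ∩ Set.Ici 0).Finite :=
    (Set.finite_Ico 0 b).subset fun x hx => ⟨hx.2, hb hx.1⟩
  have hf2 : (Set.Iio 0 \ S.1).Finite :=
    (Set.finite_Ico a 0).subset fun x hx => ⟨not_lt.mp fun h => hx.2 (ha h), hx.1⟩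
  have hterm : ∀ j : ℤ, normalOrdered j (j + 0) (ket S) =
      (Set.indicator (S.1 ∩ Set.Ici 0) (fun _ => ket S) j) +
        (Set.indicator (Set.Iio 0 \ S.1) (fun _ => -ket S) j) := by
    intro j
    rw [add_zero]
    unfold normalOrdered
    by_cases hj : j ∈ S.1 <;> by_cases h0 : j < 0
    · have : ¬ (0 ≤ j) := not_le.mpr h0
      simp [h0, hj, this, psi_ket_of_mem hj]
    · simp [h0, hj, not_lt.mp h0, hera j hj]
    · have : ¬ (0 ≤ j) := not_le.mpr h0
      simp [h0, hj, hins j hj]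
    · simp [h0, hj, psiStar_ket_of_notMem hj]
  have hsum : ∀ (T : Set ℤ) (v : Fock), T.Finite →
      ∑ᶠ j : ℤ, Set.indicator T (fun _ => v) j = (T.ncard : ℂ) • v := by
    intro T v hT
    rw [← finsum_mem_def, finsum_mem_eq_finite_toFinset_sum _ hT, Finset.sum_const,
      Set.ncard_eq_toFinset_card _ hT, Nat.cast_smul_eq_nsmul]
  change ∑ᶠ j : ℤ, normalOrdered j (j + 0) (ket S) = _
  simp only [hterm]
  rw [finsum_add_distrib (hf1.subset Set.support_indicator_subset)
    (hf2.subset Set.support_indicator_subset), hsum _ _ hf1, hsum _ _ hf2, Maya.charge]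
  push_cast
  rw [smul_neg, sub_smul, sub_eq_add_neg]

/-- The shift operator `e^{nP}`. -/
def expP (n : ℤ) : Module.End ℂ Fock := ofBasis fun S => ket (S.shift n)

/-- The projection of `H_F` onto the states of charge `c`, so that `z ^ Q = ∑_c z ^ c chargeProj c`
for the charge operator `Q`. -/
def chargeProj (c : ℤ) : Module.End ℂ Fock :=
  ofBasis fun S => if S.charge = c then ket S else 0

/-- `e^P z ^ Q`. -/
def expP_zQ (m : ℤ) : Module.End ℂ Fock := expP 1 * chargeProj m

/-- `z ^ (-Q) e^{-P}`. -/
def zQ_expP (m : ℤ) : Module.End ℂ Fock := chargeProj (-m) * expP (-1)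

/-- `J_+([x]) = ∑_{k ≥ 1} J_k x ^ k / k`. -/
def Jplus : PowerSeries (Module.End ℂ Fock) := xi fun k => ((k : ℂ)⁻¹) • J k

/-- `J_-([x]) = ∑_{k ≥ 1} J_{-k} x ^ k / k`. -/
def Jminus : PowerSeries (Module.End ℂ Fock) := xi fun k => ((k : ℂ)⁻¹) • J (-k)

/-- The normally ordered exponential of the bosonic field `φ(z)`, that is
`e^{J_-([z])} e^P z^Q e^{-J_+([z⁻¹])}`, applied to a state. -/
def expPhi (U : Fock) : ℤ → Fock :=
  prod₃ (atZ (formalExp Jminus)) expP_zQ (atZInv (formalExp (-Jplus))) U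

/-- The normally ordered exponential of `-φ(z)`, that is
`e^{-J_-([z])} z^{-Q} e^{-P} e^{J_+([z⁻¹])}`, applied to a state. -/
def expNegPhi (U : Fock) : ℤ → Fock :=
  prod₃ (atZ (formalExp (-Jminus))) zQ_expP (atZInv (formalExp Jplus)) U

/-! ### The bosonic Fock space -/

/-- `H_B = ℂ[w, w⁻¹, t₁, t₂, …]`; the variable `w` is `LaurentPolynomial.T 1`. -/
abbrev BosonFock : Type := LaurentPolynomial (MvPolynomial ℕ+ ℂ)

/-- The variable `t_k`, as an element of `H_B`. -/
def time (k : ℕ+) : BosonFock := LaurentPolynomial.C (MvPolynomial.X k)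

/-- Multiplication by `t_k`. -/
def mulTime (k : ℕ+) : Module.End ℂ BosonFock := LinearMap.mulLeft ℂ (time k)

/-- `∂ / ∂t_k`. -/
def dTime (k : ℕ+) : Module.End ℂ BosonFock where
  toFun f := AddMonoidAlgebra.ofCoeff (f.coeff.mapRange (MvPolynomial.pderiv k) (map_zero _))
  map_add' f g := by ext; simp
  map_smul' c f := by ext; simp

/-- `w ∂ / ∂w`. -/
def wdw (f : BosonFock) : BosonFock :=
  f.coeff.sum fun l p => (l : ℂ) • (LaurentPolynomial.C p * LaurentPolynomial.T l)

/-- The operator `e^{nP}`: multiplication by `w ^ n`. -/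
def bExpP (n : ℤ) : Module.End ℂ BosonFock := LinearMap.mulLeft ℂ (LaurentPolynomial.T n)

/-- The projection of `H_B` onto `w ^ c ℂ[t₁, t₂, …]`. The operator `z ^ Q : f(w) ↦ f(zw)` is
`∑_c z ^ c wProj c`. -/
def wProj (c : ℤ) : Module.End ℂ BosonFock where
  toFun f := LaurentPolynomial.C (f.coeff c) * LaurentPolynomial.T c
  map_add' f g := by simp [add_mul]
  map_smul' a f := by
    ext; simp [← LaurentPolynomial.single_eq_C_mul_T, Finsupp.single_apply]

/-- `e^P z ^ Q`. -/
def bExpP_zQ (m : ℤ) : Module.End ℂ BosonFock := bExpP 1 * wProj m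

/-- `z ^ (-Q) e^{-P}`. -/
def bzQ_expP (m : ℤ) : Module.End ℂ BosonFock := wProj (-m) * bExpP (-1)

/-- `ξ(t, x) = ∑_{k ≥ 1} t_k x ^ k`, as multiplication operators. -/
def xiTime : PowerSeries (Module.End ℂ BosonFock) := xi mulTime

/-- `ξ(∂̃, x) = ∑_{k ≥ 1} (1 / k) ∂_{t_k} x ^ k`. -/
def xiD : PowerSeries (Module.End ℂ BosonFock) := xi fun k => ((k : ℂ)⁻¹) • dTime k

/-- The vertex operator `X(z) = e^{ξ(t, z)} e^{-ξ(∂̃, z⁻¹)} e^P z^Q`, applied to `f`. -/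
def vertexX (f : BosonFock) : ℤ → BosonFock :=
  prod₃ (atZ (formalExp xiTime)) (atZInv (formalExp (-xiD))) bExpP_zQ f

/-- The vertex operator `X*(z) = e^{-ξ(t, z)} e^{ξ(∂̃, z⁻¹)} z^{-Q} e^{-P}`, applied to `f`. -/
def vertexXStar (f : BosonFock) : ℤ → BosonFock :=
  prod₃ (atZ (formalExp (-xiTime))) (atZInv (formalExp xiD)) bzQ_expP f

/-! ### The boson-fermion correspondence -/

open Classical in
/-- `J_+(t) = ∑_{k ≥ 1} t_k J_k`, a formal power series in the times: its coefficient at the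
monomial `t_k` is `J_k` and its other coefficients vanish. -/
def JplusTimes : MvPowerSeries ℕ+ (Module.End ℂ Fock) :=
  fun d => ∑ k ∈ d.support, if d = Finsupp.single k 1 then J k else 0

/-- `⟨l| e^{J_+(t)} |U⟩`, as a formal power series in the times. -/
def amplitude (l : ℤ) (U : Fock) : MvPowerSeries ℕ+ ℂ :=
  fun d => bra l (MvPowerSeries.coeff d (formalExp JplusTimes) U)

/-- `Φ(U) = ∑_l w ^ l ⟨l| e^{J_+(t)} |U⟩`, summed over the monomials `w ^ l t ^ d`. -/
def Phi (U : Fock) : BosonFock :=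
  ∑ᶠ p : ℤ × (ℕ+ →₀ ℕ), LaurentPolynomial.C
    (MvPolynomial.monomial p.2 (MvPowerSeries.coeff p.2 (amplitude p.1 U))) *
      LaurentPolynomial.T p.1

end BosonFermion

end

/-!
For a series `f` with commuting coefficients, the coefficients `E_m` of `exp f` are determined by
Newton's recursion `m E_m = ∑ j f_j E_{m-j}`. The functionals `⟨n| ψ_{n-1-m}` and `⟨n| ψ*_{n+m}`
satisfy the recursion of `exp (-J_+)` and of `exp J_+`: the commutators `[J_k, ψ_j] = ψ_{j-k}` and
`[J_k, ψ*_j] = -ψ*_{j+k}` produce its terms, and the remaining double sum of two fermions cancels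
because they anticommute. This gives the left vacua.

A field `F(z)` with `[J_k, F(z)] = c z^k F(z)` for `k > 0` is determined by the functionals
`⟨n| F(z)`, because these and the currents determine `Φ ∘ F(z)`, and `Φ` is injective. The kernel of
`Φ` is indeed stable under all `ψ*_k`, again by the left vacua, and removing fermions turns every
basis state into a vacuum, on which `⟨n|` detects it. Bosonization follows by comparing the left
vacua of both sides.

As `[J_m, J_n] = m δ_{m,-n}`, the map `Φ` intertwines the currents with `∂ / ∂t_k` and `k t_k`; it
is therefore surjective, and transports bosonization to the vertex operators. All infinite sums are
finite on each vector since `J_k` lowers the energy by `k` and the energy is nonnegative.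
-/

noncomputable section

namespace BosonFermion

/-! ### Formal exponentials -/

section FormalExp

open MvPowerSeries
open scoped Nat

variable {σ A : Type*} [Ring A]

theorem coeff_pow_of_degree_lt {f : MvPowerSeries σ A} (h0 : constantCoeff f = 0) {d : σ →₀ ℕ}
    {n : ℕ} (h : d.degree < n) : coeff d (f ^ n) = 0 :=
  coeff_of_lt_order (lt_of_lt_of_le (by exact_mod_cast h)
    (le_order_pow_of_constantCoeff_eq_zero n h0))

theorem commute_of_commute_coeff {f g : MvPowerSeries σ A}
    (h : ∀ d e, Commute (coeff d f) (coeff e g)) : Commute f g := by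
  classical
  ext d
  rw [coeff_mul, coeff_mul, Finsupp.sum_antidiagonal_swap d fun a b => coeff a f * coeff b g]
  exact Finset.sum_congr rfl fun p _ => (h _ _).eq

variable [Algebra ℂ A]

theorem coeff_formalExp (f : MvPowerSeries σ A) (d : σ →₀ ℕ) :
    coeff d (formalExp f) =
      ∑ n ∈ Finset.range (d.degree + 1), ((n ! : ℂ)⁻¹) • coeff d (f ^ n) :=
  rfl

theorem coeff_formalExp_of_degree_lt {f : MvPowerSeries σ A} (h0 : constantCoeff f = 0)
    {d : σ →₀ ℕ} {N : ℕ} (h : d.degree < N) :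
    coeff d (formalExp f) = ∑ n ∈ Finset.range N, ((n ! : ℂ)⁻¹) • coeff d (f ^ n) := by
  refine Finset.sum_subset (Finset.range_subset_range.2 h) fun n _ hn => ?_
  rw [coeff_pow_of_degree_lt h0 (by simpa using hn), smul_zero]

theorem coeff_zero_formalExp (f : MvPowerSeries σ A) : coeff 0 (formalExp f) = 1 := by
  simp [coeff_formalExp]

theorem formalExp_zero : formalExp (0 : MvPowerSeries σ A) = 1 := by
  ext d
  simp [coeff_formalExp, Finset.sum_range_succ']

theorem coeff_mul_formalExp (g : MvPowerSeries σ A) {f : MvPowerSeries σ A}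
    (h0 : constantCoeff f = 0) (d : σ →₀ ℕ) :
    coeff d (g * formalExp f) =
      ∑ n ∈ Finset.range (d.degree + 1), ((n ! : ℂ)⁻¹) • coeff d (g * f ^ n) := by
  classical
  simp only [coeff_mul, Finset.smul_sum]
  rw [Finset.sum_comm]
  refine Finset.sum_congr rfl fun p hp => ?_
  have hd : p.2.degree < d.degree + 1 := by
    rw [← Finset.HasAntidiagonal.mem_antidiagonal.1 hp, map_add]
    omega
  rw [coeff_formalExp_of_degree_lt h0 hd, Finset.mul_sum]
  exact Finset.sum_congr rfl fun n _ => mul_smul_comm ((n ! : ℂ)⁻¹) _ _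

/-- The operation on formal series that applies `δ d` to the coefficient at `d`. Both the
derivations `t ∂ / ∂t` and the commutators with an element of `A` are of this form. -/
def coeffwise (δ : (σ →₀ ℕ) → A →ₗ[ℂ] A) (f : MvPowerSeries σ A) : MvPowerSeries σ A :=
  fun d => δ d (coeff d f)

@[simp]
theorem coeff_coeffwise (δ : (σ →₀ ℕ) → A →ₗ[ℂ] A) (f : MvPowerSeries σ A) (d : σ →₀ ℕ) :
    coeff d (coeffwise δ f) = δ d (coeff d f) :=
  rfl

/-- The condition on `δ` that makes `coeffwise δ` a derivation. -/
def IsLeibniz (δ : (σ →₀ ℕ) → A →ₗ[ℂ] A) : Prop :=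
  ∀ d e a b, δ (d + e) (a * b) = δ d a * b + a * δ e b

namespace IsLeibniz

variable {δ : (σ →₀ ℕ) → A →ₗ[ℂ] A}

theorem coeffwise_mul (hδ : IsLeibniz δ) (f g : MvPowerSeries σ A) :
    coeffwise δ (f * g) = coeffwise δ f * g + f * coeffwise δ g := by
  classical
  ext d
  simp only [coeff_coeffwise, map_add, coeff_mul, map_sum, ← Finset.sum_add_distrib]
  refine Finset.sum_congr rfl fun p hp => ?_
  rw [← Finset.HasAntidiagonal.mem_antidiagonal.1 hp, hδ]

theorem coeffwise_one (hδ : IsLeibniz δ) : coeffwise δ (1 : MvPowerSeries σ A) = 0 := by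
  simpa using hδ.coeffwise_mul 1 1

theorem coeffwise_pow_succ (hδ : IsLeibniz δ) {f : MvPowerSeries σ A}
    (hf : Commute (coeffwise δ f) f) (n : ℕ) :
    coeffwise δ (f ^ (n + 1)) = (n + 1) • (coeffwise δ f * f ^ n) := by
  induction n with
  | zero => simp
  | succ n ih =>
    rw [pow_succ, hδ.coeffwise_mul, ih, smul_mul_assoc, mul_assoc, ← pow_succ,
      ← (hf.pow_right (n + 1)).eq, ← succ_nsmul]

theorem coeffwise_formalExp (hδ : IsLeibniz δ) {f : MvPowerSeries σ A}
    (h0 : constantCoeff f = 0) (hf : Commute (coeffwise δ f) f) :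
    coeffwise δ (formalExp f) = coeffwise δ f * formalExp f := by
  ext d
  rw [coeff_coeffwise, coeff_formalExp_of_degree_lt h0 (N := d.degree + 1 + 1) (by omega),
    coeff_mul_formalExp _ h0, map_sum, Finset.sum_range_succ']
  simp only [map_smul, ← coeff_coeffwise, hδ.coeffwise_pow_succ hf, pow_zero, hδ.coeffwise_one,
    map_zero, smul_zero, add_zero]
  refine Finset.sum_congr rfl fun n _ => ?_
  have hfac : (n ! : ℂ) ≠ 0 := by exact_mod_cast n.factorial_ne_zero
  have hsucc : (n + 1 : ℂ) ≠ 0 := by exact_mod_cast n.succ_ne_zero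
  rw [map_nsmul, ← Nat.cast_smul_eq_nsmul ℂ, smul_smul, Nat.factorial_succ]
  congr 1
  push_cast
  field_simp

end IsLeibniz

/-- The family for `coeffwise` that gives the Euler operator of the grading `l`, which multiplies a
monomial by its degree. -/
def euler (l : (σ →₀ ℕ) →+ ℕ) (d : σ →₀ ℕ) : A →ₗ[ℂ] A := (l d : ℂ) • LinearMap.id

theorem isLeibniz_euler (l : (σ →₀ ℕ) →+ ℕ) : IsLeibniz (A := A) (euler l) := by
  intro d e a b
  simp [euler, add_smul]

theorem coeffwise_euler_formalExp (l : (σ →₀ ℕ) →+ ℕ) {f : MvPowerSeries σ A}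
    (h0 : constantCoeff f = 0) (hf : ∀ d e, Commute (coeff d f) (coeff e f)) :
    coeffwise (euler l) (formalExp f) = coeffwise (euler l) f * formalExp f :=
  (isLeibniz_euler l).coeffwise_formalExp h0 <|
    commute_of_commute_coeff fun d e => (hf d e).smul_left (l d : ℂ)

/-- The family for `coeffwise` that gives the coefficientwise commutator with `x`. -/
def ad (x : A) (_ : σ →₀ ℕ) : A →ₗ[ℂ] A := LinearMap.mulLeft ℂ x - LinearMap.mulRight ℂ x

theorem ad_apply (x a : A) (d : σ →₀ ℕ) : ad x d a = ⁅x, a⁆ := rfl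

theorem isLeibniz_ad (x : A) : IsLeibniz (σ := σ) (ad x) := by
  intro d e a b
  simp only [ad_apply, Ring.lie_def]
  noncomm_ring

theorem lie_coeff_formalExp [DecidableEq σ] {x : A} {f : MvPowerSeries σ A}
    (h0 : constantCoeff f = 0) {e : σ →₀ ℕ} {c : ℂ}
    (h : ∀ d, ⁅x, coeff d f⁆ = if d = e then c • (1 : A) else 0) (d : σ →₀ ℕ) :
    ⁅x, coeff d (formalExp f)⁆ = if e ≤ d then c • coeff (d - e) (formalExp f) else 0 := by
  have hmon : coeffwise (ad x) f = monomial e (c • (1 : A)) := by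
    ext d
    rw [coeff_coeffwise, ad_apply, h, coeff_monomial]
  have hcomm : Commute (coeffwise (ad x) f) f := by
    rw [hmon]
    exact ((commute_monomial f).2 fun d => (Commute.one_right _).smul_right c).symm
  have hexp := congrArg (coeff d) ((isLeibniz_ad x).coeffwise_formalExp h0 hcomm)
  rwa [coeff_coeffwise, ad_apply, hmon, coeff_monomial_mul, smul_one_mul] at hexp

theorem commute_coeff_formalExp {x : A} {f : MvPowerSeries σ A}
    (h : ∀ d, Commute x (coeff d f)) (d : σ →₀ ℕ) : Commute x (coeff d (formalExp f)) := by
  have hC : Commute (C x) f := by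
    ext d
    rw [coeff_C_mul, coeff_mul_C, (h d).eq]
  rw [coeff_formalExp]
  refine Commute.sum_right _ _ _ fun n _ => Commute.smul_right ?_ _
  have hpow := congrArg (coeff d) (hC.pow_right n).eq
  rwa [coeff_C_mul, coeff_mul_C] at hpow

variable {V W : Type*} [AddCommGroup V] [Module ℂ V] [AddCommGroup W] [Module ℂ W]

theorem map_coeff_formalExp (g : V →ₗ[ℂ] W) {f : MvPowerSeries σ (Module.End ℂ V)}
    {f' : MvPowerSeries σ (Module.End ℂ W)} (h : ∀ d v, g (coeff d f v) = coeff d f' (g v))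
    (d : σ →₀ ℕ) (v : V) : g (coeff d (formalExp f) v) = coeff d (formalExp f') (g v) := by
  classical
  have hpow (n : ℕ) : ∀ d v, g (coeff d (f ^ n) v) = coeff d (f' ^ n) (g v) := by
    induction n with
    | zero =>
      intro d v
      rw [pow_zero, pow_zero, coeff_one, coeff_one]
      split_ifs <;> simp
    | succ n ih =>
      intro d v
      simp only [pow_succ, coeff_mul, LinearMap.sum_apply, Module.End.mul_apply, map_sum, ih, h]
  simp only [coeff_formalExp, LinearMap.sum_apply, map_sum, LinearMap.smul_apply, map_smul, hpow]

theorem coeff_formalExp_mem (F : ℤ → Submodule ℂ V) (w : (σ →₀ ℕ) →+ ℤ)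
    {f : MvPowerSeries σ (Module.End ℂ V)} (h : ∀ d N, ∀ v ∈ F N, coeff d f v ∈ F (N - w d))
    (d : σ →₀ ℕ) (N : ℤ) {v : V} (hv : v ∈ F N) : coeff d (formalExp f) v ∈ F (N - w d) := by
  classical
  have hpow (n : ℕ) : ∀ d N, ∀ v ∈ F N, coeff d (f ^ n) v ∈ F (N - w d) := by
    induction n with
    | zero =>
      intro d N v hv
      rw [pow_zero, coeff_one]
      split_ifs with hd
      · simpa [hd] using hv
      · exact zero_mem _
    | succ n ih =>
      intro d N v hv
      rw [pow_succ, coeff_mul, LinearMap.sum_apply]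
      refine Submodule.sum_mem _ fun p hp => ?_
      rw [← Finset.HasAntidiagonal.mem_antidiagonal.1 hp, map_add, add_comm (w p.1), ← sub_sub]
      exact ih _ _ _ (h _ _ _ hv)
  rw [coeff_formalExp, LinearMap.sum_apply]
  exact Submodule.sum_mem _ fun n _ => Submodule.smul_mem _ _ (hpow n d N v hv)

end FormalExp

section PowerSeriesExp

open Finset

variable {A : Type*} [Ring A]

theorem coeff_xi_zero (a : ℕ+ → A) : PowerSeries.coeff 0 (xi a) = 0 := by
  simp [xi]

theorem constantCoeff_xi (a : ℕ+ → A) : PowerSeries.constantCoeff (xi a) = 0 := by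
  rw [← PowerSeries.coeff_zero_eq_constantCoeff_apply, coeff_xi_zero]

theorem coeff_xi (a : ℕ+ → A) (k : ℕ+) : PowerSeries.coeff k (xi a) = a k := by
  rw [xi, PowerSeries.coeff_mk, dif_pos k.pos]
  rfl

theorem coeff_xi_induction {p : ℕ → A → Prop} (a : ℕ+ → A) (zero : p 0 0)
    (pos : ∀ k : ℕ+, p k (a k)) (n : ℕ) : p n (PowerSeries.coeff n (xi a)) := by
  obtain rfl | hn := n.eq_zero_or_pos
  · rwa [coeff_xi_zero]
  · exact coeff_xi a ⟨n, hn⟩ ▸ pos ⟨n, hn⟩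

theorem atZ_natCast (f : PowerSeries A) (n : ℕ) : atZ f n = PowerSeries.coeff n f := by
  simp [atZ]

theorem atZ_of_neg (f : PowerSeries A) {m : ℤ} (h : m < 0) : atZ f m = 0 := by
  simp [atZ, not_le.2 h]

theorem atZ_induction {p : ℤ → A → Prop} {f : PowerSeries A} (neg : ∀ m < 0, p m 0)
    (coeff : ∀ n : ℕ, p n (PowerSeries.coeff n f)) (m : ℤ) : p m (atZ f m) := by
  obtain hm | ⟨n, rfl⟩ := (lt_or_ge m 0).imp_right Int.eq_ofNat_of_zero_le
  · exact atZ_of_neg f hm ▸ neg m hm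
  · exact atZ_natCast f n ▸ coeff n

theorem coeff_neg_commute {f : PowerSeries A}
    (hf : ∀ i j, Commute (PowerSeries.coeff i f) (PowerSeries.coeff j f)) (i j : ℕ) :
    Commute (PowerSeries.coeff i (-f)) (PowerSeries.coeff j (-f)) := by
  rw [map_neg, map_neg]
  exact (hf i j).neg_left.neg_right

variable [Algebra ℂ A]

theorem coeff_zero_formalExp_powerSeries (f : PowerSeries A) :
    PowerSeries.coeff 0 (formalExp f) = 1 :=
  (congrArg (MvPowerSeries.coeff · _) (Finsupp.single_zero ())).trans (coeff_zero_formalExp f)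

theorem coeff_formalExp_newton {f : PowerSeries A} (h0 : PowerSeries.constantCoeff f = 0)
    (hf : ∀ i j, Commute (PowerSeries.coeff i f) (PowerSeries.coeff j f)) (m : ℕ) :
    (m : ℂ) • PowerSeries.coeff m (formalExp f) = ∑ p ∈ antidiagonal m,
      (p.2 : ℂ) • (PowerSeries.coeff p.1 (formalExp f) * PowerSeries.coeff p.2 f) := by
  have hcomm (d e : Unit →₀ ℕ) : Commute (MvPowerSeries.coeff d f) (MvPowerSeries.coeff e f) := by
    rw [← PowerSeries.coeff_def rfl, ← PowerSeries.coeff_def rfl]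
    exact hf _ _
  have hexp := congrArg (PowerSeries.coeff m)
    (coeffwise_euler_formalExp (Finsupp.applyAddHom ()) h0 hcomm)
  have heuler (g : PowerSeries A) (n : ℕ) :
      PowerSeries.coeff n (coeffwise (euler (Finsupp.applyAddHom ())) g : PowerSeries A) =
        (n : ℂ) • PowerSeries.coeff n g := by
    simp [PowerSeries.coeff, euler]
  have hmul : PowerSeries.coeff m (coeffwise (euler (Finsupp.applyAddHom ())) f * formalExp f) =
      ∑ p ∈ antidiagonal m,
        (p.1 : ℂ) • (PowerSeries.coeff p.1 f * PowerSeries.coeff p.2 (formalExp f)) := by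
    refine (PowerSeries.coeff_mul _ _ _).trans (sum_congr rfl fun p _ => ?_)
    rw [heuler, smul_mul_assoc]
  rw [heuler, hmul, ← Nat.sum_antidiagonal_swap] at hexp
  refine hexp.trans (sum_congr rfl fun p _ => ?_)
  exact congrArg _ ((commute_coeff_formalExp (hcomm _) _).eq)

theorem lie_coeff_formalExp_powerSeries {x : A} {f : PowerSeries A}
    (h0 : PowerSeries.constantCoeff f = 0) {k : ℕ} {c : ℂ}
    (h : ∀ n, ⁅x, PowerSeries.coeff n f⁆ = if n = k then c • (1 : A) else 0) (m : ℕ) :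
    ⁅x, PowerSeries.coeff m (formalExp f)⁆ =
      if k ≤ m then c • PowerSeries.coeff (m - k) (formalExp f) else 0 := by
  have hmv (d : Unit →₀ ℕ) : ⁅x, MvPowerSeries.coeff d f⁆ =
      if d = Finsupp.single () k then c • (1 : A) else 0 := by
    rw [← PowerSeries.coeff_def rfl, h]
    simp [Finsupp.unique_ext_iff]
  have := lie_coeff_formalExp h0 hmv (Finsupp.single () m)
  rw [← Finsupp.single_tsub] at this
  simpa [PowerSeries.coeff] using this

theorem commute_coeff_formalExp_powerSeries {x : A} {f : PowerSeries A}
    (h : ∀ n, Commute x (PowerSeries.coeff n f)) (n : ℕ) :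
    Commute x (PowerSeries.coeff n (formalExp f)) := by
  refine commute_coeff_formalExp (fun d => ?_) _
  rw [← PowerSeries.coeff_def rfl]
  exact h _

theorem commute_atZInv_formalExp {x : A} {f : PowerSeries A}
    (h : ∀ n, Commute x (PowerSeries.coeff n f)) (m : ℤ) : Commute x (atZInv (formalExp f) m) :=
  atZ_induction (p := fun _ a => Commute x a) (fun _ _ => Commute.zero_right x)
    (commute_coeff_formalExp_powerSeries h) (-m)

theorem lie_atZ_formalExp {x : A} {f : PowerSeries A}
    (h0 : PowerSeries.constantCoeff f = 0) {k : ℕ} {c : ℂ}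
    (h : ∀ n, ⁅x, PowerSeries.coeff n f⁆ = if n = k then c • (1 : A) else 0) (m : ℤ) :
    ⁅x, atZ (formalExp f) m⁆ = c • atZ (formalExp f) (m - k) := by
  refine atZ_induction (p := fun m a => ⁅x, a⁆ = c • atZ (formalExp f) (m - k))
    (fun m hm => ?_) (fun n => ?_) m
  · rw [atZ_of_neg _ (by omega), Ring.lie_def, mul_zero, zero_mul, sub_zero, smul_zero]
  · rw [lie_coeff_formalExp_powerSeries h0 h]
    split_ifs with hk
    · rw [← Nat.cast_sub hk, atZ_natCast]
    · rw [atZ_of_neg _ (by omega), smul_zero]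

variable {V W : Type*} [AddCommGroup V] [Module ℂ V] [AddCommGroup W] [Module ℂ W]

theorem coeff_formalExp_mem_powerSeries (F : ℤ → Submodule ℂ V) (w : ℕ →+ ℤ)
    {f : PowerSeries (Module.End ℂ V)}
    (h : ∀ n N, ∀ v ∈ F N, PowerSeries.coeff n f v ∈ F (N - w n)) (n : ℕ) (N : ℤ) {v : V}
    (hv : v ∈ F N) : PowerSeries.coeff n (formalExp f) v ∈ F (N - w n) := by
  have hmem := coeff_formalExp_mem (f := f) F (w.comp (Finsupp.applyAddHom ())) (fun d N v hv => ?_)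
    (Finsupp.single () n) N hv
  · simpa using hmem
  · rw [← PowerSeries.coeff_def rfl]
    exact h _ N v hv

theorem map_coeff_formalExp_powerSeries (g : V →ₗ[ℂ] W) {f : PowerSeries (Module.End ℂ V)}
    {f' : PowerSeries (Module.End ℂ W)}
    (h : ∀ n v, g (PowerSeries.coeff n f v) = PowerSeries.coeff n f' (g v)) (n : ℕ) (v : V) :
    g (PowerSeries.coeff n (formalExp f) v) = PowerSeries.coeff n (formalExp f') (g v) := by
  refine map_coeff_formalExp g (fun d v => ?_) _ v
  rw [← PowerSeries.coeff_def rfl, ← PowerSeries.coeff_def rfl]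
  exact h _ v

theorem map_coeff_xi {g : V →ₗ[ℂ] W} {a : ℕ+ → Module.End ℂ V} {b : ℕ+ → Module.End ℂ W}
    (h : ∀ k v, g (a k v) = b k (g v)) (n : ℕ) (v : V) :
    g (PowerSeries.coeff n (xi a) v) = PowerSeries.coeff n (xi b) (g v) := by
  obtain rfl | hn := n.eq_zero_or_pos
  · rw [coeff_xi_zero, coeff_xi_zero, LinearMap.zero_apply, map_zero, LinearMap.zero_apply]
  · lift n to ℕ+ using hn
    rw [coeff_xi, coeff_xi, h]

theorem map_coeff_neg {g : V →ₗ[ℂ] W} {f : PowerSeries (Module.End ℂ V)}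
    {f' : PowerSeries (Module.End ℂ W)}
    (h : ∀ n v, g (PowerSeries.coeff n f v) = PowerSeries.coeff n f' (g v)) (n : ℕ) (v : V) :
    g (PowerSeries.coeff n (-f) v) = PowerSeries.coeff n (-f') (g v) := by
  rw [map_neg, map_neg, LinearMap.neg_apply, LinearMap.neg_apply, map_neg, h]

theorem map_atZ_formalExp {g : V →ₗ[ℂ] W} {f : PowerSeries (Module.End ℂ V)}
    {f' : PowerSeries (Module.End ℂ W)}
    (h : ∀ n v, g (PowerSeries.coeff n f v) = PowerSeries.coeff n f' (g v)) (m : ℤ) (v : V) :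
    g (atZ (formalExp f) m v) = atZ (formalExp f') m (g v) := by
  obtain hm | ⟨n, rfl⟩ := (lt_or_ge m 0).imp_right Int.eq_ofNat_of_zero_le
  · rw [atZ_of_neg _ hm, atZ_of_neg _ hm, LinearMap.zero_apply, map_zero, LinearMap.zero_apply]
  · rw [atZ_natCast, atZ_natCast, map_coeff_formalExp_powerSeries g h]

theorem map_atZ_formalExp_of_map_coeff_eq_zero (g : V →ₗ[ℂ] W) {f : PowerSeries (Module.End ℂ V)}
    (h : ∀ n v, g (PowerSeries.coeff n f v) = 0) (m : ℤ) (v : V) :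
    g (atZ (formalExp f) m v) = if m = 0 then g v else 0 := by
  refine atZ_induction (p := fun m (A : Module.End ℂ V) => g (A v) = if m = 0 then g v else 0)
    (fun m hm => ?_) (fun n => ?_) m
  · rw [if_neg hm.ne, LinearMap.zero_apply, map_zero]
  · have hcoeff := map_coeff_formalExp_powerSeries (f := f) (f' := 0) g
      (fun n v => by rw [h, map_zero, LinearMap.zero_apply]) n v
    rw [hcoeff, show formalExp (0 : PowerSeries (Module.End ℂ W)) = 1 from formalExp_zero,
      PowerSeries.coeff_one, if_congr Nat.cast_eq_zero rfl rfl]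
    split_ifs <;> rfl

theorem eq_comp_coeff_formalExp {f : PowerSeries (Module.End ℂ V)}
    (h0 : PowerSeries.constantCoeff f = 0)
    (hf : ∀ i j, Commute (PowerSeries.coeff i f) (PowerSeries.coeff j f)) {χ : ℕ → V →ₗ[ℂ] W}
    (hχ : ∀ m : ℕ, (m : ℂ) • χ m =
      ∑ p ∈ antidiagonal m, (p.2 : ℂ) • (χ p.1 ∘ₗ PowerSeries.coeff p.2 f)) (m : ℕ) :
    χ m = χ 0 ∘ₗ PowerSeries.coeff m (formalExp f) := by
  induction m using Nat.strong_induction_on with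
  | _ m ih =>
    obtain rfl | hm := eq_or_ne m 0
    · rw [coeff_zero_formalExp_powerSeries]
      rfl
    refine smul_right_injective _ (Nat.cast_ne_zero (R := ℂ).2 hm) ?_
    change (m : ℂ) • χ m = (m : ℂ) • (χ 0 ∘ₗ _)
    rw [hχ, ← LinearMap.comp_smul, coeff_formalExp_newton h0 hf]
    ext v
    simp only [LinearMap.sum_apply, LinearMap.comp_apply, map_sum]
    refine sum_congr rfl fun p hp => ?_
    obtain ⟨i, j⟩ := p
    obtain rfl : i + j = m := HasAntidiagonal.mem_antidiagonal.1 hp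
    obtain rfl | hj := j.eq_zero_or_pos
    · simp
    · simp [ih i (by simpa using hj)]

end PowerSeriesExp

/-! ### Products of formal distributions of operators -/

section Act

variable {V W : Type*} [AddCommGroup V] [Module ℂ V] [AddCommGroup W] [Module ℂ W]

/-- On each vector only finitely many coefficients of `A(z)` do not vanish. -/
def PointwiseFinite (A : ℤ → Module.End ℂ V) : Prop :=
  ∀ v, (Function.support fun m => A m v).Finite

theorem act_const (A : ℤ → Module.End ℂ V) (v : V) : act A (const v) = fun m => A m v := by
  funext m
  rw [act, finsum_eq_single _ m]
  · simp [const]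
  · intro a ha
    rw [const, Pi.single_eq_of_ne (sub_ne_zero.2 ha.symm), map_zero]

theorem prod₃_eq_act_act (A B C : ℤ → Module.End ℂ V) (v : V) :
    prod₃ A B C v = act A (act B fun m => C m v) := by
  rw [prod₃, act_const]

theorem composable_of_support_finite (A : ℤ → Module.End ℂ V) {u : ℤ → V}
    (hu : (Function.support u).Finite) : Composable A u := fun m =>
  (hu.image (m - ·)).subset fun a ha =>
    ⟨m - a, fun h => ha (by simp [h]), sub_sub_cancel m a⟩

theorem PointwiseFinite.act_support_finite {A : ℤ → Module.End ℂ V} (hA : PointwiseFinite A)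
    {u : ℤ → V} (hu : (Function.support u).Finite) : (Function.support (act A u)).Finite := by
  refine (hu.biUnion fun b _ => (hA (u b)).image (· + b)).subset fun m hm => ?_
  obtain ⟨a, ha⟩ : ∃ a, A a (u (m - a)) ≠ 0 := by
    by_contra! h
    exact hm (finsum_eq_zero_of_forall_eq_zero h)
  exact Set.mem_biUnion (x := m - a) (fun h => ha (by simp [h])) ⟨a, ha, add_sub_cancel a m⟩

theorem wellDefined₃_of_pointwiseFinite (A : ℤ → Module.End ℂ V) {B C : ℤ → Module.End ℂ V}
    (hB : PointwiseFinite B) (hC : PointwiseFinite C) : WellDefined₃ A B C := by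
  intro v
  have hv : (Function.support (const v)).Finite :=
    (Set.finite_singleton 0).subset Pi.support_single_subset
  exact ⟨composable_of_support_finite _ hv,
    composable_of_support_finite _ (hC.act_support_finite hv),
    composable_of_support_finite _ (hB.act_support_finite (hC.act_support_finite hv))⟩

theorem map_act (g : V →ₗ[ℂ] W) {A : ℤ → Module.End ℂ V} {B : ℤ → Module.End ℂ W}
    (h : ∀ a v, g (A a v) = B a (g v)) {u : ℤ → V} (hu : (Function.support u).Finite) (m : ℤ) :
    g (act A u m) = act B (fun b => g (u b)) m := by
  rw [act, act, map_finsum g (composable_of_support_finite A hu m)]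
  simp only [h]

theorem map_prod₃ (g : V →ₗ[ℂ] W) {A B C : ℤ → Module.End ℂ V} {A' B' C' : ℤ → Module.End ℂ W}
    (hB : PointwiseFinite B) (hC : PointwiseFinite C) (hAA' : ∀ a v, g (A a v) = A' a (g v))
    (hBB' : ∀ a v, g (B a v) = B' a (g v)) (hCC' : ∀ a v, g (C a v) = C' a (g v)) (v : V)
    (m : ℤ) : g (prod₃ A B C v m) = prod₃ A' B' C' (g v) m := by
  simp only [prod₃_eq_act_act, map_act g hAA' (hB.act_support_finite (hC v)),
    map_act g hBB' (hC v), hCC']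

theorem act_act_const_comm {B C : ℤ → Module.End ℂ V} (h : ∀ a b, Commute (B a) (C b)) (v : V) :
    act B (act C (const v)) = act C (act B (const v)) := by
  funext m
  rw [act_const, act_const, act, act, ← finsum_comp_equiv (Equiv.subLeft m)]
  refine finsum_congr fun a => ?_
  rw [Equiv.subLeft_apply, sub_sub_cancel, ← Module.End.mul_apply, (h _ _).eq,
    Module.End.mul_apply]

theorem apply_act {A : ℤ → Module.End ℂ V} {x : Module.End ℂ V} {c : ℂ} {k : ℤ}
    (hA : ∀ a, ⁅x, A a⁆ = c • A (a - k)) {u : ℤ → V} (hu : (Function.support u).Finite) (m : ℤ) :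
    x (act A u m) = act A (fun b => x (u b)) m + c • act A u (m - k) := by
  have hxu : (Function.support fun b => x (u b)).Finite :=
    hu.subset (Function.support_comp_subset (map_zero x) u)
  have hshift : act A u (m - k) = ∑ᶠ a, A (a - k) (u (m - a)) := by
    rw [act, ← finsum_comp_equiv (Equiv.subRight k)]
    simp
  have hfin : (Function.support fun a => c • A (a - k) (u (m - a))).Finite :=
    (composable_of_support_finite (fun a => c • A (a - k)) hu m)
  rw [hshift, smul_finsum, act, act, map_finsum x (composable_of_support_finite A hu m),
    ← finsum_add_distrib (composable_of_support_finite A hxu m) hfin]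
  refine finsum_congr fun a => ?_
  have hcomm := LinearMap.congr_fun (hA a) (u (m - a))
  rwa [Ring.lie_def, LinearMap.sub_apply, sub_eq_iff_eq_add'] at hcomm

theorem apply_prod₃ {A B C : ℤ → Module.End ℂ V} (hB : PointwiseFinite B)
    (hC : PointwiseFinite C) {x : Module.End ℂ V} {c : ℂ} {k : ℤ}
    (hA : ∀ a, ⁅x, A a⁆ = c • A (a - k)) (hxB : ∀ a, Commute x (B a))
    (hxC : ∀ a, Commute x (C a)) (v : V) (m : ℤ) :
    x (prod₃ A B C v m) = prod₃ A B C (x v) m + c • prod₃ A B C v (m - k) := by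
  simp only [prod₃_eq_act_act, apply_act hA (hB.act_support_finite (hC v)),
    map_act x (fun a v => LinearMap.congr_fun (hxB a).eq v) (hC v),
    fun a => LinearMap.congr_fun (hxC a).eq v, ← Module.End.mul_apply]

theorem PointwiseFinite.of_surjective {g : V →ₗ[ℂ] W} (hg : Function.Surjective g)
    {A : ℤ → Module.End ℂ V} {A' : ℤ → Module.End ℂ W} (h : ∀ m v, g (A m v) = A' m (g v))
    (hA : PointwiseFinite A) : PointwiseFinite A' := by
  intro w
  obtain ⟨v, rfl⟩ := hg w
  simp only [← h]
  exact (hA v).subset (Function.support_comp_subset (map_zero g) _)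

theorem commute_of_surjective {g : V →ₗ[ℂ] W} (hg : Function.Surjective g) {A B : Module.End ℂ V}
    {A' B' : Module.End ℂ W} (hA : ∀ v, g (A v) = A' (g v)) (hB : ∀ v, g (B v) = B' (g v))
    (h : Commute A B) : Commute A' B' := by
  refine LinearMap.ext fun w => ?_
  obtain ⟨v, rfl⟩ := hg w
  rw [Module.End.mul_apply, Module.End.mul_apply, ← hA, ← hB, ← hA, ← hB]
  exact congrArg g (LinearMap.congr_fun h.eq v)

/-- The vertex operators carry the factors `B(z)` and `C(z)` in the order opposite to that of the
bosonization formulas. -/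
theorem map_prod₃_swap {g : V →ₗ[ℂ] W} (hg : Function.Surjective g) {A B C : ℤ → Module.End ℂ V}
    {A' B' C' : ℤ → Module.End ℂ W} (hB : PointwiseFinite B) (hC : PointwiseFinite C)
    (hBC : ∀ a b, Commute (B a) (C b)) (hAA' : ∀ a v, g (A a v) = A' a (g v))
    (hBB' : ∀ a v, g (B a v) = B' a (g v)) (hCC' : ∀ a v, g (C a v) = C' a (g v)) (v : V) :
    (fun m => g (prod₃ A B C v m)) = prod₃ A' C' B' (g v) := by
  funext m
  rw [map_prod₃ g hB hC hAA' hBB' hCC', prod₃, prod₃,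
    act_act_const_comm fun a b => commute_of_surjective hg (hBB' a) (hCC' b) (hBC a b)]

end Act

/-! ### Fermions -/

section Fermions

namespace Maya

theorem mem_insert {k j : ℤ} {S : Maya} : j ∈ (S.insert k).1 ↔ j = k ∨ j ∈ S.1 := Iff.rfl

theorem mem_erase {k j : ℤ} {S : Maya} : j ∈ (S.erase k).1 ↔ j ∈ S.1 ∧ j ≠ k := Iff.rfl

theorem mem_vac {n j : ℤ} : j ∈ (vac n).1 ↔ j < n := Iff.rfl

theorem mem_shift {n j : ℤ} {S : Maya} : j ∈ (S.shift n).1 ↔ j - n ∈ S.1 := Iff.rfl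

@[ext]
theorem ext {S T : Maya} (h : ∀ j, j ∈ S.1 ↔ j ∈ T.1) : S = T := Subtype.ext (Set.ext h)

theorem insert_erase {k : ℤ} {S : Maya} (h : k ∈ S.1) : (S.erase k).insert k = S := by
  ext j
  grind [mem_insert, mem_erase]

theorem erase_insert {k : ℤ} {S : Maya} (h : k ∉ S.1) : (S.insert k).erase k = S := by
  ext j
  grind [mem_insert, mem_erase]

theorem inter_Ioi_finite (k : ℤ) (S : Maya) : (S.1 ∩ Set.Ioi k).Finite := by
  obtain ⟨-, b, -, hb⟩ := S.2
  exact (Set.finite_Ioo k b).subset fun x hx => ⟨hx.2, hb hx.1⟩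

/-- The sign in `ψ_k` and `ψ*_k` on the basis state of `S`, from moving a fermion past the elements
of `S` above `k`. -/
def sign (k : ℤ) (S : Maya) : ℂ := (-1) ^ S.above k

theorem sign_mul_self (k : ℤ) (S : Maya) : S.sign k * S.sign k = 1 := by
  simp [sign, ← mul_pow]

theorem sign_insert {j : ℤ} {S : Maya} (h : j ∉ S.1) (k : ℤ) :
    (S.insert j).sign k = if k < j then -S.sign k else S.sign k := by
  have hval : (S.insert j).1 = Insert.insert j S.1 := rfl
  unfold sign above
  split_ifs with hk
  · rw [hval, Set.insert_inter_of_mem (Set.mem_Ioi.2 hk),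
      Set.ncard_insert_of_notMem (fun h' => h h'.1) (S.inter_Ioi_finite k), pow_succ, mul_neg_one]
  · rw [hval, Set.insert_inter_of_notMem (mt Set.mem_Ioi.1 hk)]

theorem sign_erase {j : ℤ} {S : Maya} (h : j ∈ S.1) (k : ℤ) :
    (S.erase j).sign k = if k < j then -S.sign k else S.sign k := by
  have hsign := sign_insert (S := S.erase j) (fun h' => (mem_erase.1 h').2 rfl) k
  rw [insert_erase h] at hsign
  rw [hsign]
  split_ifs
  · rw [neg_neg]
  · rfl

theorem sign_shift (n k : ℤ) (S : Maya) : (S.shift n).sign k = S.sign (k - n) := by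
  unfold sign above
  rw [← Set.ncard_image_of_injective (S.1 ∩ Set.Ioi (k - n)) (add_left_injective n)]
  congr 2
  ext x
  simp [mem_shift, sub_eq_add_neg]

theorem charge_vac (n : ℤ) : (vac n).charge = n := by
  have hpos : (vac n).1 ∩ Set.Ici 0 = Finset.Ico 0 n := by
    ext x
    simp [mem_vac, and_comm]
  have hneg : Set.Iio 0 \ (vac n).1 = Finset.Ico n 0 := by
    ext x
    simp [mem_vac, and_comm]
  rw [charge, hpos, hneg, Set.ncard_coe_finset, Set.ncard_coe_finset, Int.card_Ico, Int.card_Ico]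
  omega

end Maya

theorem fock_hom_ext {M : Type*} [AddCommMonoid M] [Module ℂ M] {f g : Fock →ₗ[ℂ] M}
    (h : ∀ S, f (ket S) = g (ket S)) : f = g :=
  Finsupp.lhom_ext' fun S => LinearMap.ext_ring (h S)

theorem ofBasis_ket (f : Maya → Fock) (S : Maya) : ofBasis f (ket S) = f S := by
  simp [ofBasis, ket]

open Classical in
theorem ket_apply (S T : Maya) : ket S T = if S = T then 1 else 0 := Finsupp.single_apply

theorem apply_eq_mul_of_ket {A : Module.End ℂ Fock} {S R : Maya} {c : ℂ}
    (h : ∀ T, A (ket T) S = c * ket T R) (U : Fock) : A U S = c * U R := by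
  have hext : Finsupp.lapply S ∘ₗ A = c • Finsupp.lapply R := fock_hom_ext h
  exact LinearMap.congr_fun hext U

open Classical in
theorem psi_apply (k : ℤ) (U : Fock) (S : Maya) :
    psi k U S = if k ∈ S.1 then S.sign k * U (S.erase k) else 0 := by
  have hket (T : Maya) :
      psi k (ket T) S = if k ∈ T.1 then 0 else T.sign k * ket (T.insert k) S := by
    rw [psi, ofBasis_ket]
    split_ifs
    · rfl
    · rfl
  split_ifs with hk
  · refine apply_eq_mul_of_ket (fun T => ?_) U
    rw [hket, ket_apply, ket_apply]
    grind [Maya.insert_erase, Maya.erase_insert, Maya.sign_insert, Maya.mem_erase]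
  · rw [apply_eq_mul_of_ket (c := 0) (R := S) (fun T => ?_), zero_mul]
    rw [hket, ket_apply]
    grind [Maya.mem_insert]

open Classical in
theorem psiStar_apply (k : ℤ) (U : Fock) (S : Maya) :
    psiStar k U S = if k ∈ S.1 then 0 else S.sign k * U (S.insert k) := by
  have hket (T : Maya) :
      psiStar k (ket T) S = if k ∈ T.1 then T.sign k * ket (T.erase k) S else 0 := by
    rw [psiStar, ofBasis_ket]
    split_ifs
    · rfl
    · rfl
  split_ifs with hk
  · rw [apply_eq_mul_of_ket (c := 0) (R := S) (fun T => ?_), zero_mul]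
    rw [hket, ket_apply]
    grind [Maya.mem_erase]
  · refine apply_eq_mul_of_ket (fun T => ?_) U
    rw [hket, ket_apply, ket_apply]
    grind [Maya.insert_erase, Maya.erase_insert, Maya.sign_erase, Maya.mem_insert]

theorem expP_apply (n : ℤ) (U : Fock) (S : Maya) : expP n U S = U (S.shift (-n)) := by
  classical
  rw [apply_eq_mul_of_ket (c := 1) (fun T => ?_), one_mul]
  have hshift : T.shift n = S ↔ T = S.shift (-n) := by
    constructor
    · rintro rfl
      ext j
      simp [Maya.mem_shift]
    · rintro rfl
      ext j
      simp [Maya.mem_shift]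
  rw [expP, ofBasis_ket, ket_apply, ket_apply, one_mul]
  exact if_congr hshift rfl rfl

theorem chargeProj_apply (c : ℤ) (U : Fock) (S : Maya) :
    chargeProj c U S = if S.charge = c then U S else 0 := by
  rw [apply_eq_mul_of_ket (c := if S.charge = c then 1 else 0) (fun T => ?_), ite_mul, one_mul,
    zero_mul]
  rw [chargeProj, ofBasis_ket]
  obtain rfl | hT := eq_or_ne T S
  · split_ifs <;> simp
  · split_ifs <;> simp [ket, Finsupp.single_eq_of_ne' hT]

theorem J_zero_apply (U : Fock) (S : Maya) : J 0 U S = S.charge * U S := by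
  refine apply_eq_mul_of_ket (fun T => ?_) U
  rw [J_zero_ket]
  obtain rfl | hT := eq_or_ne T S
  · rfl
  · simp [ket, Finsupp.single_eq_of_ne' hT]

theorem psi_mul_psi (j k : ℤ) : psi j * psi k = -(psi k * psi j) := by
  classical
  refine LinearMap.ext fun U => Finsupp.ext fun S => ?_
  have herase : (S.erase j).erase k = (S.erase k).erase j := by
    ext i
    grind [Maya.mem_erase]
  simp only [Module.End.mul_apply, LinearMap.neg_apply, Finsupp.neg_apply, psi_apply, herase]
  grind [Maya.mem_erase, Maya.sign_erase]

theorem psiStar_mul_psiStar (j k : ℤ) : psiStar j * psiStar k = -(psiStar k * psiStar j) := by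
  classical
  refine LinearMap.ext fun U => Finsupp.ext fun S => ?_
  have hinsert : (S.insert j).insert k = (S.insert k).insert j := by
    ext i
    grind [Maya.mem_insert]
  simp only [Module.End.mul_apply, LinearMap.neg_apply, Finsupp.neg_apply, psiStar_apply, hinsert]
  grind [Maya.mem_insert, Maya.sign_insert]

theorem psi_mul_psiStar_add (j k : ℤ) :
    psi j * psiStar k + psiStar k * psi j = if j = k then 1 else 0 := by
  classical
  refine LinearMap.ext fun U => Finsupp.ext fun S => ?_
  simp only [LinearMap.add_apply, Module.End.mul_apply, Finsupp.add_apply, psi_apply,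
    psiStar_apply]
  obtain rfl | hjk := eq_or_ne j k
  · grind [Maya.mem_insert, Maya.mem_erase, Maya.sign_insert, Maya.sign_erase, Maya.insert_erase,
      Maya.erase_insert, Maya.sign_mul_self, Module.End.one_apply]
  · have hswap : (S.erase j).insert k = (S.insert k).erase j := by
      ext i
      grind [Maya.mem_erase, Maya.mem_insert]
    rw [hswap]
    grind [Maya.mem_insert, Maya.mem_erase, Maya.sign_insert, Maya.sign_erase,
      LinearMap.zero_apply]

theorem expP_mul_psi (n k : ℤ) : expP n * psi k = psi (k + n) * expP n := by
  classical
  refine LinearMap.ext fun U => Finsupp.ext fun S => ?_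
  have herase : (S.shift (-n)).erase k = (S.erase (k + n)).shift (-n) := by
    ext j
    simp [Maya.mem_erase, Maya.mem_shift]
  simp [psi_apply, expP_apply, herase, Maya.sign_shift, Maya.mem_shift]

theorem expP_mul_psiStar (n k : ℤ) : expP n * psiStar k = psiStar (k + n) * expP n := by
  classical
  refine LinearMap.ext fun U => Finsupp.ext fun S => ?_
  have hinsert : (S.shift (-n)).insert k = (S.insert (k + n)).shift (-n) := by
    ext j
    simp [Maya.mem_insert, Maya.mem_shift]
  simp [psiStar_apply, expP_apply, hinsert, Maya.sign_shift, Maya.mem_shift]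

end Fermions

/-! ### Currents -/

/-- Without this shortcut, ring lemmas do not unify with the additive structure of linear maps. -/
local instance endFockRing : Ring (Module.End ℂ Fock) := Module.End.instRing

section Currents

theorem normalOrdered_eq (j l : ℤ) :
    normalOrdered j l = psi j * psiStar l - if j = l ∧ j < 0 then 1 else 0 := by
  have hanti := psi_mul_psiStar_add j l
  unfold normalOrdered
  split_ifs at hanti ⊢ with h h' h'
  all_goals grind

theorem lie_normalOrdered (j l : ℤ) (T : Module.End ℂ Fock) :
    ⁅normalOrdered j l, T⁆ = ⁅psi j * psiStar l, T⁆ := by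
  rw [normalOrdered_eq, Ring.lie_def, Ring.lie_def]
  split_ifs <;> simp only [sub_mul, mul_sub, one_mul, mul_one, sub_zero, sub_sub_sub_cancel_right]

theorem lie_psi_mul_psiStar_psi (i l j : ℤ) :
    ⁅psi i * psiStar l, psi j⁆ = if l = j then psi i else 0 := by
  have hmul : psiStar l * psi j = (if j = l then 1 else 0) - psi j * psiStar l :=
    eq_sub_of_add_eq' (psi_mul_psiStar_add j l)
  rw [Ring.lie_def, mul_assoc, hmul, mul_sub, ← mul_assoc, psi_mul_psi i j, mul_ite, mul_one,
    mul_zero, if_congr eq_comm rfl rfl]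
  noncomm_ring

theorem lie_psi_mul_psiStar_psiStar (i l j : ℤ) :
    ⁅psi i * psiStar l, psiStar j⁆ = -if i = j then psiStar l else 0 := by
  have hmul : psi i * psiStar j = (if i = j then 1 else 0) - psiStar j * psi i :=
    eq_sub_of_add_eq (psi_mul_psiStar_add i j)
  rw [Ring.lie_def, mul_assoc, psiStar_mul_psiStar, mul_neg, ← mul_assoc, hmul, sub_mul, ite_mul,
    one_mul, zero_mul]
  noncomm_ring

theorem J_apply (k : ℤ) (U : Fock) : J k U = ∑ᶠ j : ℤ, normalOrdered j (j + k) U := rfl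

theorem map_J {M : Type*} [AddCommGroup M] [Module ℂ M] (g : Fock →ₗ[ℂ] M) (k : ℤ) (U : Fock) :
    g (J k U) = ∑ᶠ j : ℤ, g (normalOrdered j (j + k) U) :=
  map_finsum g (normalOrdered_support_finite k U)

theorem map_normalOrdered_support_finite {M : Type*} [AddCommGroup M] [Module ℂ M]
    (g : Fock →ₗ[ℂ] M) (k : ℤ) (U : Fock) :
    (Function.support fun j : ℤ => g (normalOrdered j (j + k) U)).Finite :=
  (normalOrdered_support_finite k U).subset (Function.support_comp_subset (map_zero g) _)

theorem lie_J_apply (k : ℤ) (T : Module.End ℂ Fock) (U : Fock) :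
    ⁅J k, T⁆ U = ∑ᶠ j : ℤ, ⁅psi j * psiStar (j + k), T⁆ U := by
  rw [Ring.lie_def, LinearMap.sub_apply, Module.End.mul_apply, Module.End.mul_apply, map_J,
    J_apply, ← finsum_sub_distrib (normalOrdered_support_finite k (T U))
      (map_normalOrdered_support_finite T k U)]
  refine finsum_congr fun j => ?_
  rw [← lie_normalOrdered]
  rfl

theorem lie_J_psi (k j : ℤ) : ⁅J k, psi j⁆ = psi (j - k) := by
  refine LinearMap.ext fun U => ?_
  simp only [lie_J_apply, lie_psi_mul_psiStar_psi]
  rw [finsum_eq_single _ (j - k) fun i hi => by rw [if_neg (by omega), LinearMap.zero_apply],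
    if_pos (sub_add_cancel j k)]

theorem lie_J_psiStar (k j : ℤ) : ⁅J k, psiStar j⁆ = -psiStar (j + k) := by
  refine LinearMap.ext fun U => ?_
  simp only [lie_J_apply, lie_psi_mul_psiStar_psiStar]
  rw [finsum_eq_single _ j fun i hi => by simp [hi], if_pos rfl]

theorem lie_J_psi_mul_psiStar (k i l : ℤ) :
    ⁅J k, psi i * psiStar l⁆ = psi (i - k) * psiStar l - psi i * psiStar (l + k) := by
  have hpsiStar : psiStar (l + k) = -⁅J k, psiStar l⁆ := by rw [lie_J_psiStar, neg_neg]
  rw [← lie_J_psi, hpsiStar, Ring.lie_def, Ring.lie_def, Ring.lie_def]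
  noncomm_ring

theorem finsum_ite_mem_finset {M : Type*} [AddCommMonoid M] (s : Finset ℤ) (v : M) :
    ∑ᶠ i : ℤ, (if i ∈ s then v else 0) = s.card • v := by
  rw [finsum_eq_sum_of_support_subset _ fun i hi => by by_contra h; exact hi (if_neg h),
    Finset.sum_ite_mem, Finset.inter_self, Finset.sum_const]

theorem ite_mem_finset_support_finite {M : Type*} [AddCommMonoid M] (s : Finset ℤ) (v : M) :
    (Function.support fun i : ℤ => if i ∈ s then v else 0).Finite :=
  s.finite_toSet.subset fun i hi => by by_contra h; exact hi (if_neg h)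

theorem comp_sub_support_finite {M : Type*} [Zero M] {f : ℤ → M}
    (hf : (Function.support f).Finite) (n : ℤ) :
    (Function.support fun i => f (i - n)).Finite :=
  hf.preimage (sub_left_injective (b := n)).injOn

theorem finsum_sub_comp_sub {M : Type*} [AddCommGroup M] {f : ℤ → M}
    (hf : (Function.support f).Finite) (n : ℤ) : ∑ᶠ i : ℤ, (f i - f (i - n)) = 0 := by
  rw [finsum_sub_distrib hf (comp_sub_support_finite hf n), sub_eq_zero]
  exact (finsum_comp_equiv (Equiv.subRight n)).symm

theorem ite_neg_sub_ite_lt {M : Type*} [AddCommGroup M] (n i : ℤ) (v : M) :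
    ((if i < 0 then v else 0) - if i < n then v else 0) =
      (if i ∈ Finset.Ico n 0 then v else 0) - if i ∈ Finset.Ico 0 n then v else 0 := by
  grind

theorem ite_neg_sub_ite_lt_support_finite {M : Type*} [AddCommGroup M] (n : ℤ) (v : M) :
    (Function.support fun i : ℤ => (if i < 0 then v else 0) - if i < n then v else 0).Finite := by
  simp only [ite_neg_sub_ite_lt]
  exact ((ite_mem_finset_support_finite _ v).union (ite_mem_finset_support_finite _ v)).subset
    (Function.support_sub _ _)

theorem finsum_ite_neg_sub_ite_lt {M : Type*} [AddCommGroup M] [Module ℂ M] (n : ℤ) (v : M) :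
    ∑ᶠ i : ℤ, ((if i < 0 then v else 0) - if i < n then v else 0) = -((n : ℂ) • v) := by
  have hcard : ((n - 0).toNat : ℂ) = (0 - n).toNat + n := by
    exact_mod_cast show ((n - 0).toNat : ℤ) = (0 - n).toNat + n by omega
  simp only [ite_neg_sub_ite_lt]
  rw [finsum_sub_distrib (ite_mem_finset_support_finite _ v) (ite_mem_finset_support_finite _ v),
    finsum_ite_mem_finset, finsum_ite_mem_finset, Int.card_Ico, Int.card_Ico,
    ← Nat.cast_smul_eq_nsmul ℂ, ← Nat.cast_smul_eq_nsmul ℂ, hcard, add_smul]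
  abel

theorem lie_psi_mul_psiStar_J (m n j : ℤ) :
    ⁅psi j * psiStar (j + m), J n⁆ =
      (normalOrdered j (j + (m + n)) - normalOrdered (j - n) (j - n + (m + n))) +
        if m + n = 0 then (if j < 0 then 1 else 0) - (if j < n then 1 else 0) else 0 := by
  have hskew : ⁅psi j * psiStar (j + m), J n⁆ = -⁅J n, psi j * psiStar (j + m)⁆ := by
    rw [Ring.lie_def, Ring.lie_def, neg_sub]
  rw [hskew, lie_J_psi_mul_psiStar, normalOrdered_eq, normalOrdered_eq,
    show j + m + n = j + (m + n) by ring, show j - n + (m + n) = j + m by ring]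
  split_ifs <;> first | omega | abel

/-- Commuting `J_n` past the terms of `J_m` and restoring the normal order gives a telescoping sum
and a finite sum of constants, which is the central term. -/
theorem lie_J_J (m n : ℤ) : ⁅J m, J n⁆ = if m + n = 0 then (m : ℂ) • 1 else 0 := by
  refine LinearMap.ext fun U => ?_
  have hfinite := normalOrdered_support_finite (m + n) U
  have htelescope := finsum_sub_comp_sub hfinite n
  have htelescope_finite := (hfinite.union (comp_sub_support_finite hfinite n)).subset
    (Function.support_sub _ _)
  rw [lie_J_apply]
  simp only [lie_psi_mul_psiStar_J]
  split_ifs with h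
  · have hconst (j : ℤ) : (if j < 0 then (1 : Module.End ℂ Fock) else 0) U -
        (if j < n then (1 : Module.End ℂ Fock) else 0) U =
          (if j < 0 then U else 0) - if j < n then U else 0 := by
      split_ifs <;> rfl
    simp only [LinearMap.add_apply, LinearMap.sub_apply, hconst]
    rw [finsum_add_distrib htelescope_finite (ite_neg_sub_ite_lt_support_finite n U), htelescope,
      finsum_ite_neg_sub_ite_lt, zero_add, eq_neg_of_add_eq_zero_left h, Int.cast_neg, neg_smul]
    rfl
  · simpa only [add_zero, LinearMap.zero_apply, LinearMap.sub_apply] using htelescope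

theorem J_commute {m n : ℤ} (h : m + n ≠ 0) : Commute (J m) (J n) :=
  commute_iff_lie_eq.2 (by rw [lie_J_J, if_neg h])

theorem normalOrdered_of_ne {j l : ℤ} (h : j ≠ l) : normalOrdered j l = psi j * psiStar l := by
  rw [normalOrdered_eq, if_neg (fun h' => h h'.1), sub_zero]

theorem J_commute_expP {k : ℤ} (hk : k ≠ 0) (n : ℤ) : Commute (J k) (expP n) := by
  have hterm (j : ℤ) : expP n * normalOrdered j (j + k) =
      normalOrdered (j + n) (j + n + k) * expP n := by
    rw [normalOrdered_of_ne (by omega), normalOrdered_of_ne (by omega), ← mul_assoc, expP_mul_psi,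
      mul_assoc, expP_mul_psiStar, ← mul_assoc, add_right_comm]
  refine Commute.symm (LinearMap.ext fun U => ?_)
  calc expP n (J k U) = ∑ᶠ j : ℤ, expP n (normalOrdered j (j + k) U) := map_J _ _ _
    _ = ∑ᶠ j : ℤ, normalOrdered (j + n) (j + n + k) (expP n U) :=
      finsum_congr fun j => LinearMap.congr_fun (hterm j) U
    _ = J k (expP n U) := finsum_comp_equiv (f := fun j => normalOrdered j (j + k) (expP n U))
      (Equiv.addRight n)

theorem commute_chargeProj {A : Module.End ℂ Fock} (h : Commute (J 0) A) (c : ℤ) :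
    Commute A (chargeProj c) := by
  classical
  refine Commute.symm (fock_hom_ext fun T => Finsupp.ext fun S => ?_)
  have heigen : (S.charge : ℂ) * A (ket T) S = T.charge * A (ket T) S := by
    have hcomm := LinearMap.congr_fun h.eq (ket T)
    rw [Module.End.mul_apply, Module.End.mul_apply, J_zero_ket, map_smul] at hcomm
    rw [← J_zero_apply, hcomm, Finsupp.smul_apply, smul_eq_mul]
  have hket : chargeProj c (ket T) = if T.charge = c then ket T else 0 := ofBasis_ket _ T
  rw [Module.End.mul_apply, Module.End.mul_apply, chargeProj_apply, hket]
  obtain hcharge | hzero := mul_eq_mul_right_iff.1 heigen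
  · rw [Int.cast_inj.1 hcharge]
    split_ifs <;> simp
  · split_ifs <;> simp [hzero]

theorem J_commute_chargeProj (k c : ℤ) : Commute (J k) (chargeProj c) := by
  obtain rfl | hk := eq_or_ne k 0
  · exact commute_chargeProj (Commute.refl _) c
  · exact commute_chargeProj (J_commute (by omega)) c

end Currents

/-! ### Left vacua -/

section Bra

open Finset

theorem bra_apply (n : ℤ) (U : Fock) : bra n U = U (Maya.vac n) := rfl

theorem Maya.insert_vac (n : ℤ) : (Maya.vac n).insert n = Maya.vac (n + 1) := by
  ext j
  grind [Maya.mem_insert, Maya.mem_vac]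

theorem Maya.erase_vac (n : ℤ) : (Maya.vac (n + 1)).erase n = Maya.vac n := by
  ext j
  grind [Maya.mem_erase, Maya.mem_vac]

theorem Maya.shift_vac (k n : ℤ) : (Maya.vac n).shift k = Maya.vac (n + k) := by
  ext j
  grind [Maya.mem_shift, Maya.mem_vac]

theorem Maya.sign_vac {n k : ℤ} (h : n ≤ k + 1) : (Maya.vac n).sign k = 1 := by
  have hempty : (Maya.vac n).1 ∩ Set.Ioi k = ∅ := by
    ext x
    simp only [Set.mem_inter_iff, Maya.mem_vac, Set.mem_Ioi, Set.mem_empty_iff_false,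
      iff_false]
    omega
  rw [Maya.sign, Maya.above, hempty, Set.ncard_empty, pow_zero]

theorem bra_psi_of_le {n k : ℤ} (h : n ≤ k) (U : Fock) : bra n (psi k U) = 0 := by
  rw [bra_apply, psi_apply, if_neg (mt Maya.mem_vac.1 (not_lt.2 h))]

theorem bra_psiStar_of_lt {n k : ℤ} (h : k < n) (U : Fock) : bra n (psiStar k U) = 0 := by
  rw [bra_apply, psiStar_apply, if_pos (Maya.mem_vac.2 h)]

theorem bra_psi_self (n : ℤ) (U : Fock) : bra (n + 1) (psi n U) = bra n U := by
  rw [bra_apply, psi_apply, if_pos (Maya.mem_vac.2 (lt_add_one n)), Maya.sign_vac le_rfl, one_mul,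
    Maya.erase_vac, bra_apply]

theorem bra_psiStar_self (n : ℤ) (U : Fock) : bra n (psiStar n U) = bra (n + 1) U := by
  rw [bra_apply, psiStar_apply, if_neg (mt Maya.mem_vac.1 (lt_irrefl n)),
    Maya.sign_vac (by omega), one_mul, Maya.insert_vac, bra_apply]

theorem bra_expP (n k : ℤ) (U : Fock) : bra n (expP k U) = bra (n - k) U := by
  rw [bra_apply, expP_apply, Maya.shift_vac, bra_apply, sub_eq_add_neg]

theorem bra_chargeProj (n c : ℤ) (U : Fock) :
    bra n (chargeProj c U) = if n = c then bra n U else 0 := by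
  rw [bra_apply, chargeProj_apply, Maya.charge_vac, bra_apply]

theorem bra_J_zero (n : ℤ) (U : Fock) : bra n (J 0 U) = n * bra n U := by
  rw [bra_apply, J_zero_apply, Maya.charge_vac, bra_apply]

theorem bra_psi_psiStar_of_ne {n j l : ℤ} (hjl : j ≠ l) (h : n ≤ j ∨ l < n) (U : Fock) :
    bra n (psi j (psiStar l U)) = 0 := by
  obtain h | h := h
  · exact bra_psi_of_le h _
  · have hanti := LinearMap.congr_fun (psi_mul_psiStar_add j l) U
    rw [if_neg hjl] at hanti
    have hbra := congrArg (bra n) (eq_neg_of_add_eq_zero_left hanti)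
    rwa [Module.End.mul_apply, Module.End.mul_apply, map_neg, bra_psiStar_of_lt h, neg_zero] at hbra

theorem bra_J {k : ℤ} (hk : k ≠ 0) (n : ℤ) (U : Fock) :
    bra n (J k U) = ∑ᶠ j : ℤ, bra n (psi j (psiStar (j + k) U)) := by
  rw [map_J]
  exact finsum_congr fun j => by rw [normalOrdered_of_ne (by omega)]; rfl

theorem bra_J_of_neg {k : ℤ} (hk : k < 0) (n : ℤ) (U : Fock) : bra n (J k U) = 0 := by
  rw [bra_J hk.ne]
  exact finsum_eq_zero_of_forall_eq_zero fun j => bra_psi_psiStar_of_ne (by omega) (by omega) U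

theorem finsum_int_eq_sum_range {M : Type*} [AddCommMonoid M] {g : ℤ → M} {m : ℕ}
    (hg : ∀ j : ℤ, j < 0 ∨ m ≤ j → g j = 0) : ∑ᶠ j, g j = ∑ a ∈ range m, g a := by
  change _ = ∑ a ∈ range m, g (Nat.castEmbedding a)
  rw [← sum_map]
  refine finsum_eq_sum_of_support_subset g fun j hj => ?_
  have hrange : 0 ≤ j ∧ j < m := by
    by_contra h
    exact hj (hg j (by omega))
  simp only [coe_map, Set.mem_image, mem_coe, mem_range, Nat.castEmbedding_apply]
  exact ⟨j.toNat, by omega, by omega⟩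

/-- The indices `j` with `n - k ≤ j < n`, which alone contribute to `⟨n| J_k`, are enumerated by
`e`. -/
theorem bra_J_eq_sum_range {k : ℤ} (hk : k ≠ 0) (n : ℤ) {m : ℕ} (e : ℤ ≃ ℤ)
    (he : ∀ a : ℤ, a < 0 ∨ m ≤ a → n ≤ e a ∨ e a + k < n) (U : Fock) :
    bra n (J k U) = ∑ a ∈ range m, bra n (psi (e a) (psiStar (e a + k) U)) := by
  rw [bra_J hk, ← finsum_comp_equiv e]
  exact finsum_int_eq_sum_range fun a ha => bra_psi_psiStar_of_ne (by omega) (he a ha) U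

theorem sum_sum_eq_zero_of_antisymm {ι M : Type*} [AddCommGroup M] [IsAddTorsionFree M]
    (s : Finset ι) {f : ι → ι → M} (hf : ∀ a b, f a b = -f b a) :
    ∑ b ∈ s, ∑ a ∈ s, f a b = 0 := by
  refine self_eq_neg.1 ?_
  calc ∑ b ∈ s, ∑ a ∈ s, f a b = ∑ a ∈ s, ∑ b ∈ s, f a b := sum_comm
    _ = ∑ a ∈ s, ∑ b ∈ s, -f b a := sum_congr rfl fun a _ => sum_congr rfl fun b _ => hf a b
    _ = -∑ b ∈ s, ∑ a ∈ s, f a b := by simp only [sum_neg_distrib]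

theorem sum_bra_J_psi (n : ℤ) (m : ℕ) (U : Fock) :
    ∑ i ∈ range m, bra n (J (m - i) (psi (n - 1 - i) U)) = 0 := by
  let f (a i : ℕ) : ℂ :=
    bra n ((psi (n - 1 - i) * psi (n - 1 - a)) (psiStar (n - 1 - a - i + m) U))
  have hf (a i : ℕ) : f a i = -f i a := by
    simp only [f]
    rw [psi_mul_psi, LinearMap.neg_apply, map_neg, sub_right_comm (n - 1) (a : ℤ)]
  rw [← sum_sum_eq_zero_of_antisymm (range m) hf]
  refine sum_congr rfl fun i hi => ?_
  rw [mem_range] at hi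
  rw [bra_J_eq_sum_range (m := m) (by omega) n (Equiv.subLeft (n - 1))
    (by simp only [Equiv.subLeft_apply]; omega)]
  refine sum_congr rfl fun a ha => ?_
  rw [mem_range] at ha
  have hanti := psi_mul_psiStar_add (n - 1 - i) (n - 1 - a + (m - i))
  rw [if_neg (by omega)] at hanti
  simp only [Equiv.subLeft_apply, f]
  rw [psi_mul_psi, show n - 1 - a - i + (m : ℤ) = n - 1 - a + (m - i) by ring]
  have hU : psiStar (n - 1 - a + (m - i)) (psi (n - 1 - i) U) =
      -psi (n - 1 - i) (psiStar (n - 1 - a + (m - i)) U) :=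
    LinearMap.congr_fun (eq_neg_of_add_eq_zero_right hanti) U
  rw [hU, map_neg, LinearMap.neg_apply, map_neg]
  rfl

theorem sum_bra_J_psiStar (n : ℤ) (m : ℕ) (U : Fock) :
    ∑ i ∈ range m, bra n (J (m - i) (psiStar (n + i) U)) = 0 := by
  let f (a i : ℕ) : ℂ := bra n (psi (n - m + (a + i)) ((psiStar (n + a) * psiStar (n + i)) U))
  have hf (a i : ℕ) : f a i = -f i a := by
    simp only [f]
    rw [psiStar_mul_psiStar, LinearMap.neg_apply, map_neg, map_neg, add_comm (a : ℤ)]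
  rw [← sum_sum_eq_zero_of_antisymm (range m) hf]
  refine sum_congr rfl fun i hi => ?_
  rw [mem_range] at hi
  rw [bra_J_eq_sum_range (m := m) (by omega) n (Equiv.addLeft (n - (m - i)))
    (by simp only [Equiv.coe_addLeft]; omega)]
  refine sum_congr rfl fun a _ => ?_
  simp only [Equiv.coe_addLeft]
  rw [show n - (m - i) + a + ((m : ℤ) - i) = n + a by ring,
    show n - ((m : ℤ) - i) + a = n - m + (a + i) by ring]
  rfl

theorem sum_bra_psi_J (n : ℤ) (m : ℕ) (U : Fock) :
    ∑ i ∈ range m, bra n (psi (n - 1 - i) (J (m - i) U)) = -(m * bra n (psi (n - 1 - m) U)) := by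
  have hterm (i : ℕ) : bra n (psi (n - 1 - i) (J (m - i) U)) =
      bra n (J (m - i) (psi (n - 1 - i) U)) - bra n (psi (n - 1 - m) U) := by
    have hlie : J (m - i) (psi (n - 1 - i) U) - psi (n - 1 - i) (J (m - i) U) =
        psi (n - 1 - i - (m - i)) U := LinearMap.congr_fun (lie_J_psi _ _) U
    rw [sub_sub_sub_cancel_right] at hlie
    rw [← hlie, map_sub, sub_sub_cancel]
  rw [sum_congr rfl fun i _ => hterm i, sum_sub_distrib, sum_bra_J_psi, sum_const, card_range,
    nsmul_eq_mul, zero_sub]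

theorem sum_bra_psiStar_J (n : ℤ) (m : ℕ) (U : Fock) :
    ∑ i ∈ range m, bra n (psiStar (n + i) (J (m - i) U)) = m * bra n (psiStar (n + m) U) := by
  have hterm (i : ℕ) : bra n (psiStar (n + i) (J (m - i) U)) =
      bra n (J (m - i) (psiStar (n + i) U)) + bra n (psiStar (n + m) U) := by
    have hlie : J (m - i) (psiStar (n + i) U) - psiStar (n + i) (J (m - i) U) =
        -psiStar (n + i + (m - i)) U := LinearMap.congr_fun (lie_J_psiStar _ _) U
    rw [add_assoc, add_sub_cancel, sub_eq_iff_eq_add', ← sub_eq_add_neg] at hlie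
    rw [hlie, map_sub, sub_add_cancel]
  rw [sum_congr rfl fun i _ => hterm i, sum_add_distrib, sum_bra_J_psiStar, sum_const, card_range,
    nsmul_eq_mul, zero_add]

theorem natCast_smul_coeff_Jplus {k : ℕ} (hk : 0 < k) :
    (k : ℂ) • PowerSeries.coeff k Jplus = J k := by
  lift k to ℕ+ using hk
  rw [show PowerSeries.coeff k Jplus = ((k : ℂ)⁻¹) • J k from coeff_xi _ k, smul_smul,
    mul_inv_cancel₀ (Nat.cast_ne_zero.2 k.ne_zero), one_smul]

theorem coeff_Jplus_commute (i j : ℕ) :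
    Commute (PowerSeries.coeff i Jplus) (PowerSeries.coeff j Jplus) := by
  refine coeff_xi_induction (p := fun _ A => Commute A (PowerSeries.coeff j Jplus)) _
    (Commute.zero_left _) (fun k => ?_) i
  refine coeff_xi_induction (p := fun _ A => Commute _ A) _ (Commute.zero_right _) (fun l => ?_) j
  exact ((J_commute (by positivity)).smul_left _).smul_right _

theorem sum_antidiagonal_comp_coeff_Jplus {V : Type*} [AddCommGroup V] [Module ℂ V]
    (χ : ℕ → Fock →ₗ[ℂ] V) (m : ℕ) (U : Fock) :
    ∑ p ∈ antidiagonal m, (p.2 : ℂ) • χ p.1 (PowerSeries.coeff p.2 Jplus U) =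
      ∑ i ∈ range m, χ i (J (m - i) U) := by
  rw [Nat.sum_antidiagonal_eq_sum_range_succ (fun i j => (j : ℂ) •
    (χ i (PowerSeries.coeff j Jplus U))), sum_range_succ, Nat.sub_self, Nat.cast_zero, zero_smul,
    add_zero]
  refine sum_congr rfl fun i hi => ?_
  rw [mem_range] at hi
  rw [← map_smul, ← LinearMap.smul_apply, natCast_smul_coeff_Jplus (by omega), Nat.cast_sub hi.le]

theorem bra_psi_sub_natCast (n : ℤ) (m : ℕ) (U : Fock) :
    bra n (psi (n - 1 - m) U) = bra (n - 1) (PowerSeries.coeff m (formalExp (-Jplus)) U) := by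
  let χ (i : ℕ) : Fock →ₗ[ℂ] ℂ := bra n ∘ₗ psi (n - 1 - i)
  have hχ₀ : χ 0 = bra (n - 1) := LinearMap.ext fun V => by
    simpa [χ] using bra_psi_self (n - 1) V
  rw [← hχ₀]
  refine LinearMap.congr_fun (eq_comp_coeff_formalExp (f := -Jplus) (χ := χ) ?_ (fun i j => ?_)
    (fun m => LinearMap.ext fun V => ?_) m) U
  · rw [map_neg, Jplus, constantCoeff_xi, neg_zero]
  · exact coeff_neg_commute coeff_Jplus_commute i j
  · simp only [LinearMap.sum_apply, LinearMap.smul_apply, LinearMap.comp_apply, map_neg,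
      LinearMap.neg_apply, smul_neg, sum_neg_distrib, sum_antidiagonal_comp_coeff_Jplus]
    exact (neg_eq_iff_eq_neg.2 (sum_bra_psi_J n m V)).symm

theorem bra_psiStar_add_natCast (n : ℤ) (m : ℕ) (U : Fock) :
    bra n (psiStar (n + m) U) = bra (n + 1) (PowerSeries.coeff m (formalExp Jplus) U) := by
  let χ (i : ℕ) : Fock →ₗ[ℂ] ℂ := bra n ∘ₗ psiStar (n + i)
  have hχ₀ : χ 0 = bra (n + 1) := LinearMap.ext fun V => by
    simpa [χ] using bra_psiStar_self n V
  rw [← hχ₀]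
  refine LinearMap.congr_fun (eq_comp_coeff_formalExp (χ := χ) ?_ coeff_Jplus_commute
    (fun m => LinearMap.ext fun V => ?_) m) U
  · rw [Jplus, constantCoeff_xi]
  · simp only [LinearMap.sum_apply, LinearMap.smul_apply, LinearMap.comp_apply,
      sum_antidiagonal_comp_coeff_Jplus]
    exact (sum_bra_psiStar_J n m V).symm

theorem bra_psiField (n m : ℤ) (U : Fock) :
    bra n (psiField U m) = bra (n - 1) (atZInv (formalExp (-Jplus)) (m - (n - 1)) U) := by
  rw [psiField, atZInv]
  obtain h | h := lt_or_ge m n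
  · obtain ⟨j, hj⟩ := Int.eq_ofNat_of_zero_le (show 0 ≤ n - 1 - m by omega)
    rw [neg_sub, hj, atZ_natCast, ← bra_psi_sub_natCast, ← hj, sub_sub_cancel]
  · rw [atZ_of_neg _ (by omega), bra_psi_of_le h, LinearMap.zero_apply, map_zero]

theorem bra_psiStarField (n m : ℤ) (U : Fock) :
    bra n (psiStarField U m) = bra (n + 1) (atZInv (formalExp Jplus) (m + n) U) := by
  rw [psiStarField, atZInv]
  obtain h | h := lt_or_ge (-m) n
  · rw [atZ_of_neg _ (by omega), bra_psiStar_of_lt h, LinearMap.zero_apply, map_zero]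
  · obtain ⟨j, hj⟩ := Int.eq_ofNat_of_zero_le (show 0 ≤ -(m + n) by omega)
    rw [hj, atZ_natCast, ← bra_psiStar_add_natCast, ← hj, show n + -(m + n) = -m by ring]

end Bra

/-! ### Energy -/

section Energy

namespace Maya

open Classical in
/-- The contribution of the site `s` to the energy, relative to the state of `{k < 0}`. -/
def energyAt (S : Maya) (s : ℤ) : ℤ := if s ∈ S.1 then max s 0 else max (-s) 0

/-- The energy of a state: the sum of its positive elements and of the absolute values of the
negative integers it lacks. -/
def energy (S : Maya) : ℤ := ∑ᶠ s, S.energyAt s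

theorem energyAt_nonneg (S : Maya) (s : ℤ) : 0 ≤ S.energyAt s := by
  unfold energyAt
  split_ifs <;> exact le_max_right _ _

theorem energy_nonneg (S : Maya) : 0 ≤ S.energy := finsum_nonneg S.energyAt_nonneg

theorem energyAt_support_finite (S : Maya) : (Function.support S.energyAt).Finite := by
  obtain ⟨a, b, ha, hb⟩ := S.2
  refine (Set.finite_Icc (min a 0) (max b 0)).subset fun s hs => ?_
  have hlow : s < a → s ∈ S.1 := (ha ·)
  have hup : s ∈ S.1 → s < b := (hb ·)
  contrapose! hs
  rw [Function.notMem_support, energyAt]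
  grind

theorem energy_insert {k : ℤ} {S : Maya} (h : k ∉ S.1) :
    (S.insert k).energy = S.energy + k := by
  have hat : (S.insert k).energyAt = fun s => S.energyAt s + (Pi.single k k : ℤ → ℤ) s := by
    funext s
    grind [energyAt, mem_insert]
  rw [energy, hat, finsum_add_distrib S.energyAt_support_finite
    ((Set.finite_singleton k).subset Pi.support_single_subset), energy,
    finsum_eq_single (Pi.single k k) k fun s hs => by simp [hs], Pi.single_eq_same]

theorem energy_erase {k : ℤ} {S : Maya} (h : k ∈ S.1) : (S.erase k).energy = S.energy - k := by
  have hinsert := energy_insert (S := S.erase k) (k := k) fun h' => h'.2 rfl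
  rw [insert_erase h] at hinsert
  omega

end Maya

/-- The span of the states of energy at most `N`. -/
def energyLE (N : ℤ) : Submodule ℂ Fock := Finsupp.supported ℂ ℂ {S | S.energy ≤ N}

theorem mem_energyLE {N : ℤ} {U : Fock} :
    U ∈ energyLE N ↔ ∀ S : Maya, N < S.energy → U S = 0 := by
  simp only [energyLE, Finsupp.mem_supported', Set.mem_ofPred_eq, not_le]

theorem energyLE_mono : Monotone energyLE := fun _ _ h =>
  Finsupp.supported_mono fun _ hS => le_trans hS h

theorem eq_zero_of_mem_energyLE {N : ℤ} (hN : N < 0) {U : Fock} (hU : U ∈ energyLE N) : U = 0 :=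
  Finsupp.ext fun S => mem_energyLE.1 hU S (hN.trans_le S.energy_nonneg)

theorem exists_mem_energyLE (U : Fock) : ∃ N, U ∈ energyLE N := by
  induction U using Finsupp.induction_linear with
  | zero => exact ⟨0, zero_mem _⟩
  | add U V hU hV =>
    obtain ⟨N, hN⟩ := hU
    obtain ⟨M, hM⟩ := hV
    exact ⟨max N M, add_mem (energyLE_mono (le_max_left _ _) hN)
      (energyLE_mono (le_max_right _ _) hM)⟩
  | single S c => exact ⟨S.energy, Finsupp.single_mem_supported ℂ c (le_refl S.energy)⟩

theorem psi_mem_energyLE (k : ℤ) {N : ℤ} {U : Fock} (hU : U ∈ energyLE N) :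
    psi k U ∈ energyLE (N + k) := by
  refine mem_energyLE.2 fun S hS => ?_
  rw [psi_apply]
  split_ifs with h
  · rw [mem_energyLE.1 hU _ (by rw [Maya.energy_erase h]; omega), mul_zero]
  · rfl

theorem psiStar_mem_energyLE (k : ℤ) {N : ℤ} {U : Fock} (hU : U ∈ energyLE N) :
    psiStar k U ∈ energyLE (N - k) := by
  refine mem_energyLE.2 fun S hS => ?_
  rw [psiStar_apply]
  split_ifs with h
  · rfl
  · rw [mem_energyLE.1 hU _ (by rw [Maya.energy_insert h]; omega), mul_zero]

theorem J_mem_energyLE {k : ℤ} (hk : k ≠ 0) {N : ℤ} {U : Fock} (hU : U ∈ energyLE N) :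
    J k U ∈ energyLE (N - k) := by
  rw [J_apply]
  refine finsum_induction (· ∈ energyLE (N - k)) (zero_mem _) (fun _ _ => add_mem) fun j => ?_
  rw [normalOrdered_of_ne (by omega), show N - k = N - (j + k) + j by ring]
  exact psi_mem_energyLE j (psiStar_mem_energyLE (j + k) hU)

theorem coeff_Jplus_mem_energyLE (n : ℕ) {N : ℤ} {U : Fock} (hU : U ∈ energyLE N) :
    PowerSeries.coeff n Jplus U ∈ energyLE (N - n) := by
  refine coeff_xi_induction (p := fun n (A : Module.End ℂ Fock) => A U ∈ energyLE (N - n)) _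
    (zero_mem _) (fun k => ?_) n
  exact Submodule.smul_mem _ _ (J_mem_energyLE (by positivity) hU)

theorem pointwiseFinite_atZInv {f : PowerSeries (Module.End ℂ Fock)}
    (hf : ∀ (n : ℕ) N, ∀ U ∈ energyLE N, PowerSeries.coeff n f U ∈ energyLE (N - n)) :
    PointwiseFinite (atZInv f) := by
  intro U
  obtain ⟨N, hN⟩ := exists_mem_energyLE U
  refine (Set.finite_Icc (-N) 0).subset fun m hm => ?_
  contrapose! hm
  refine Function.notMem_support.2 ?_
  rw [atZInv]
  obtain h | h := lt_or_ge 0 m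
  · rw [atZ_of_neg _ (by omega), LinearMap.zero_apply]
  · obtain ⟨n, hn⟩ := Int.eq_ofNat_of_zero_le (show 0 ≤ -m by omega)
    have hmN : N - n < 0 := by
      rw [Set.mem_Icc] at hm
      omega
    rw [hn, atZ_natCast]
    exact eq_zero_of_mem_energyLE hmN (hf n N U hN)

theorem pointwiseFinite_atZInv_formalExp_Jplus : PointwiseFinite (atZInv (formalExp Jplus)) :=
  pointwiseFinite_atZInv fun n N _ => coeff_formalExp_mem_powerSeries (f := Jplus) energyLE
    (Nat.castAddMonoidHom ℤ) (fun n _ _ => coeff_Jplus_mem_energyLE n) n N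

theorem pointwiseFinite_atZInv_formalExp_neg_Jplus :
    PointwiseFinite (atZInv (formalExp (-Jplus))) :=
  pointwiseFinite_atZInv fun n N _ => coeff_formalExp_mem_powerSeries (f := -Jplus) energyLE
    (Nat.castAddMonoidHom ℤ) (fun n N U hU => by
      rw [map_neg]
      exact neg_mem (coeff_Jplus_mem_energyLE n hU)) n N

end Energy

/-! ### The exponential of `J_+(t)` -/

section ExpTimes

theorem coeff_single_JplusTimes (k : ℕ+) :
    MvPowerSeries.coeff (Finsupp.single k 1) JplusTimes = J k := by
  classical
  change ∑ j ∈ (Finsupp.single k 1).support,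
    (if Finsupp.single k 1 = Finsupp.single j 1 then J j else 0) = J k
  rw [Finsupp.support_single k one_ne_zero, Finset.sum_singleton, if_pos rfl]

theorem coeff_JplusTimes_of_ne {d : ℕ+ →₀ ℕ} (h : ∀ k, d ≠ Finsupp.single k 1) :
    MvPowerSeries.coeff d JplusTimes = 0 :=
  Finset.sum_eq_zero fun j _ => if_neg (h j)

theorem coeff_JplusTimes_induction {p : (ℕ+ →₀ ℕ) → Module.End ℂ Fock → Prop}
    (ne : ∀ d, (∀ k, d ≠ Finsupp.single k 1) → p d 0)
    (single : ∀ k : ℕ+, p (Finsupp.single k 1) (J k)) (d : ℕ+ →₀ ℕ) :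
    p d (MvPowerSeries.coeff d JplusTimes) := by
  by_cases! hd : ∃ k, d = Finsupp.single k 1
  · obtain ⟨k, rfl⟩ := hd
    rw [coeff_single_JplusTimes]
    exact single k
  · rw [coeff_JplusTimes_of_ne hd]
    exact ne d hd

theorem constantCoeff_JplusTimes : MvPowerSeries.constantCoeff JplusTimes = 0 := by
  rw [← MvPowerSeries.coeff_zero_eq_constantCoeff_apply]
  exact coeff_JplusTimes_of_ne fun k h => one_ne_zero (Finsupp.single_eq_zero.1 h.symm)

theorem commute_coeff_JplusTimes {x : Module.End ℂ Fock} (h : ∀ k : ℕ+, Commute x (J k))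
    (d : ℕ+ →₀ ℕ) : Commute x (MvPowerSeries.coeff d JplusTimes) :=
  coeff_JplusTimes_induction (p := fun _ A => Commute x A) (fun _ _ => Commute.zero_right x) h d

/-- The coefficient of `t ^ d` in `e^{J_+(t)}`. -/
def expTimes (d : ℕ+ →₀ ℕ) : Module.End ℂ Fock := MvPowerSeries.coeff d (formalExp JplusTimes)

theorem expTimes_zero : expTimes 0 = 1 := coeff_zero_formalExp _

theorem commute_expTimes {x : Module.End ℂ Fock} (h : ∀ k : ℕ+, Commute x (J k)) (d : ℕ+ →₀ ℕ) :
    Commute x (expTimes d) :=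
  commute_coeff_formalExp (commute_coeff_JplusTimes h) d

theorem expTimes_add_single (d : ℕ+ →₀ ℕ) (k : ℕ+) :
    (d k + 1 : ℂ) • expTimes (d + Finsupp.single k 1) = J k * expTimes d := by
  classical
  have hcomm (d e : ℕ+ →₀ ℕ) : Commute (MvPowerSeries.coeff d JplusTimes)
      (MvPowerSeries.coeff e JplusTimes) :=
    commute_coeff_JplusTimes (fun i => (commute_coeff_JplusTimes
      (fun j => J_commute (by positivity)) d).symm) e
  have hmon : coeffwise (euler (Finsupp.applyAddHom k)) JplusTimes =
      MvPowerSeries.monomial (Finsupp.single k 1) (J k) := by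
    ext1 e
    rw [coeff_coeffwise, MvPowerSeries.coeff_monomial]
    refine coeff_JplusTimes_induction (p := fun e A => euler (Finsupp.applyAddHom k) e A =
      if e = Finsupp.single k 1 then J k else 0) (fun e he => ?_) (fun j => ?_) e
    · rw [map_zero, if_neg (he k)]
    · obtain rfl | hj := eq_or_ne j k
      · simp [euler]
      · simp [euler, hj, Finsupp.single_left_inj]
  have hexp := congrArg (MvPowerSeries.coeff (Finsupp.single k 1 + d))
    (coeffwise_euler_formalExp (Finsupp.applyAddHom k) constantCoeff_JplusTimes hcomm)
  rw [hmon, MvPowerSeries.coeff_add_monomial_mul, add_comm (Finsupp.single k 1)] at hexp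
  simpa [euler, expTimes] using hexp

theorem lie_J_neg_expTimes (k : ℕ+) (d : ℕ+ →₀ ℕ) :
    ⁅J (-k), expTimes d⁆ =
      if Finsupp.single k 1 ≤ d then (-k : ℂ) • expTimes (d - Finsupp.single k 1) else 0 := by
  classical
  refine lie_coeff_formalExp constantCoeff_JplusTimes (fun d => ?_) d
  refine coeff_JplusTimes_induction (p := fun d A => ⁅J (-k), A⁆ =
    if d = Finsupp.single k 1 then (-k : ℂ) • 1 else 0) (fun d hd => ?_) (fun j => ?_) d
  · rw [if_neg (hd k), Ring.lie_def, mul_zero, zero_mul, sub_zero]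
  · have hjk : -(k : ℤ) + j = 0 ↔ Finsupp.single j 1 = Finsupp.single k 1 := by
      rw [Finsupp.single_left_inj one_ne_zero, neg_add_eq_zero, Nat.cast_inj, PNat.coe_inj, eq_comm]
    rw [lie_J_J, if_congr hjk rfl rfl, Int.cast_neg, Int.cast_natCast]

/-- The weight `∑ k d_k` of the monomial `t ^ d`. -/
def timesWeight : (ℕ+ →₀ ℕ) →+ ℕ := Finsupp.weight fun k : ℕ+ => (k : ℕ)

theorem expTimes_mem_energyLE (d : ℕ+ →₀ ℕ) {N : ℤ} {U : Fock} (hU : U ∈ energyLE N) :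
    expTimes d U ∈ energyLE (N - timesWeight d) := by
  refine coeff_formalExp_mem energyLE ((Nat.castAddMonoidHom ℤ).comp timesWeight)
    (fun d N U hU => ?_) d N hU
  refine coeff_JplusTimes_induction (p := fun d A => A U ∈ energyLE (N - timesWeight d))
    (fun _ _ => zero_mem _) (fun k => ?_) d
  rw [timesWeight, Finsupp.weight_single, one_smul]
  exact J_mem_energyLE (by positivity) hU

theorem timesWeight_le_finite (M : ℕ) : {d | timesWeight d ≤ M}.Finite := by
  classical
  refine (Set.finite_Iic (Finsupp.indicator ((Finset.range M).image Nat.succPNat)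
    fun _ _ => M)).subset fun d (hd : timesWeight d ≤ M) k => ?_
  obtain hk | hk := eq_or_ne (d k) 0
  · rw [hk]
    exact Nat.zero_le _
  have hsite : (k : ℕ) ≤ M :=
    (Finsupp.le_weight_of_ne_zero' (fun k : ℕ+ => (k : ℕ)) hk).trans hd
  have hexponent : d k ≤ M := (Finsupp.le_weight (fun k : ℕ+ => (k : ℕ)) k.ne_zero d).trans hd
  rwa [Finsupp.indicator_of_mem]
  exact Finset.mem_image.2 ⟨k.natPred, Finset.mem_range.2 (by grind [PNat.natPred_add_one]),
    k.succPNat_natPred⟩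

theorem coeff_amplitude (l : ℤ) (d : ℕ+ →₀ ℕ) (U : Fock) :
    MvPowerSeries.coeff d (amplitude l U) = bra l (expTimes d U) := rfl

theorem Maya.vac_injective : Function.Injective Maya.vac :=
  Function.LeftInverse.injective Maya.charge_vac

theorem bra_expTimes_support_finite (U : Fock) :
    (Function.support fun p : ℤ × (ℕ+ →₀ ℕ) => bra p.1 (expTimes p.2 U)).Finite := by
  obtain ⟨N, hN⟩ := exists_mem_energyLE U
  have hfin (d : ℕ+ →₀ ℕ) : (Function.support fun l => bra l (expTimes d U)).Finite :=
    (expTimes d U).hasFiniteSupport.preimage Maya.vac_injective.injOn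
  refine ((timesWeight_le_finite N.toNat).biUnion fun d _ =>
    (hfin d).image fun l => (l, d)).subset ?_
  rintro ⟨l, d⟩ hp
  refine Set.mem_biUnion (x := d) ?_ ⟨l, hp, rfl⟩
  by_contra! h
  rw [Set.mem_ofPred_eq, not_le] at h
  refine hp ?_
  change bra l (expTimes d U) = 0
  rw [eq_zero_of_mem_energyLE (by omega) (expTimes_mem_energyLE d hN), map_zero]

end ExpTimes

/-! ### The map `Φ` -/

section BosonFock

theorem bosonFock_ext {f g : BosonFock}
    (h : ∀ l d, MvPolynomial.coeff d (f.coeff l) = MvPolynomial.coeff d (g.coeff l)) : f = g :=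
  LaurentPolynomial.ext fun l => MvPolynomial.ext _ _ fun d => h l d

theorem coeff_C_mul_T (p : MvPolynomial ℕ+ ℂ) (n l : ℤ) :
    (LaurentPolynomial.C p * LaurentPolynomial.T n).coeff l = if n = l then p else 0 := by
  rw [← LaurentPolynomial.single_eq_C_mul_T, AddMonoidAlgebra.coeff_single, Finsupp.single_apply]

theorem coeff_dTime (k : ℕ+) (f : BosonFock) (l : ℤ) :
    (dTime k f).coeff l = MvPolynomial.pderiv k (f.coeff l) := rfl

theorem coeff_time_mul (k : ℕ+) (f : BosonFock) (l : ℤ) :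
    (time k * f).coeff l = MvPolynomial.X k * f.coeff l :=
  AddMonoidAlgebra.coeff_single_zero_mul _ _ _

theorem coeff_bExpP (n : ℤ) (f : BosonFock) (l : ℤ) : (bExpP n f).coeff l = f.coeff (l - n) := by
  have hmul := AddMonoidAlgebra.coeff_single_mul_add f (1 : MvPolynomial ℕ+ ℂ) n (l - n)
  rwa [add_sub_cancel, one_mul] at hmul

theorem coeff_wProj (c : ℤ) (f : BosonFock) (l : ℤ) :
    (wProj c f).coeff l = if c = l then f.coeff l else 0 := by
  refine (coeff_C_mul_T _ c l).trans ?_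
  split_ifs with h
  · rw [h]
  · rfl

theorem coeff_wdw (f : BosonFock) (l : ℤ) : (wdw f).coeff l = (l : ℂ) • f.coeff l := by
  rw [wdw, AddMonoidAlgebra.coeff_finsuppSum, Finsupp.sum_apply, Finsupp.sum_eq_single l]
  · rw [AddMonoidAlgebra.coeff_smul_apply, coeff_C_mul_T, if_pos rfl]
  · intro j _ hj
    rw [AddMonoidAlgebra.coeff_smul_apply, coeff_C_mul_T, if_neg hj, smul_zero]
  · intro _
    simp

end BosonFock

section Phi

theorem coeff_Phi (U : Fock) (l : ℤ) (d : ℕ+ →₀ ℕ) :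
    MvPolynomial.coeff d ((Phi U).coeff l) = bra l (expTimes d U) := by
  classical
  let coeffHom : BosonFock →+ ℂ :=
    AddMonoidHom.mk' (fun f => MvPolynomial.coeff d (f.coeff l)) fun f g => by simp
  have hterm (p : ℤ × (ℕ+ →₀ ℕ)) : coeffHom (LaurentPolynomial.C (MvPolynomial.monomial p.2
      (MvPowerSeries.coeff p.2 (amplitude p.1 U))) * LaurentPolynomial.T p.1) =
      if p = (l, d) then bra l (expTimes d U) else 0 := by
    obtain ⟨l', d'⟩ := p
    change MvPolynomial.coeff d ((LaurentPolynomial.C _ * LaurentPolynomial.T l').coeff l) = _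
    rw [coeff_C_mul_T, apply_ite (MvPolynomial.coeff d), MvPolynomial.coeff_monomial]
    grind [coeff_amplitude, MvPolynomial.coeff_zero]
  change coeffHom (Phi U) = _
  rw [Phi, AddMonoidHom.map_finsum]
  · rw [finsum_congr hterm, finsum_eq_single _ (l, d) fun p hp => if_neg hp, if_pos rfl]
  · refine (bra_expTimes_support_finite U).subset fun p hp hzero => hp ?_
    change bra p.1 (expTimes p.2 U) = 0 at hzero
    simp [coeff_amplitude, hzero]

theorem coe_coeff_Phi (U : Fock) (l : ℤ) :
    (((Phi U).coeff l : MvPolynomial ℕ+ ℂ) : MvPowerSeries ℕ+ ℂ) = amplitude l U := by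
  ext d
  rw [MvPolynomial.coeff_coe, coeff_Phi, coeff_amplitude]

/-- `Φ` as a linear map. -/
def PhiHom : Fock →ₗ[ℂ] BosonFock where
  toFun := Phi
  map_add' U V := bosonFock_ext fun l d => by simp [coeff_Phi]
  map_smul' c U := bosonFock_ext fun l d => by simp [coeff_Phi]

theorem coeff_Phi_of_commute {x : Module.End ℂ Fock} (h : ∀ k : ℕ+, Commute x (J k)) (U : Fock)
    (l : ℤ) (d : ℕ+ →₀ ℕ) :
    MvPolynomial.coeff d ((Phi (x U)).coeff l) = bra l (x (expTimes d U)) := by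
  rw [coeff_Phi, ← Module.End.mul_apply, ← (commute_expTimes h d).eq, Module.End.mul_apply]

theorem Phi_J_pos (k : ℕ+) (U : Fock) : Phi (J k U) = dTime k (Phi U) := by
  refine bosonFock_ext fun l d => ?_
  rw [coeff_Phi_of_commute fun j => J_commute (by positivity), coeff_dTime,
    MvPolynomial.coeff_pderiv, coeff_Phi, ← Module.End.mul_apply, ← expTimes_add_single]
  simp [mul_comm]

theorem Phi_J_zero (U : Fock) : Phi (J 0 U) = wdw (Phi U) := by
  refine bosonFock_ext fun l d => ?_
  rw [coeff_Phi_of_commute fun k => J_commute (by positivity), coeff_wdw, MvPolynomial.coeff_smul,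
    coeff_Phi, bra_J_zero, smul_eq_mul]

theorem Phi_J_neg (k : ℕ+) (U : Fock) : Phi (J (-k) U) = (k : ℂ) • (time k * Phi U) := by
  refine bosonFock_ext fun l d => ?_
  have hlie := congrArg (bra l) (LinearMap.congr_fun (lie_J_neg_expTimes k d) U)
  rw [Ring.lie_def, LinearMap.sub_apply, map_sub, Module.End.mul_apply, Module.End.mul_apply,
    bra_J_of_neg (by simp), zero_sub, neg_eq_iff_eq_neg] at hlie
  have hk : Finsupp.single k 1 ≤ d ↔ k ∈ d.support := by
    rw [Finsupp.single_le_iff, Finsupp.mem_support_iff, Nat.one_le_iff_ne_zero]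
  rw [coeff_Phi, hlie, AddMonoidAlgebra.coeff_smul_apply, coeff_time_mul, MvPolynomial.coeff_smul,
    MvPolynomial.coeff_X_mul', coeff_Phi, if_congr hk rfl rfl]
  split_ifs <;> simp

theorem Phi_expP (n : ℤ) (U : Fock) : Phi (expP n U) = bExpP n (Phi U) := by
  refine bosonFock_ext fun l d => ?_
  rw [coeff_Phi_of_commute fun k => (J_commute_expP (by positivity) n).symm, coeff_bExpP,
    coeff_Phi, bra_expP]

theorem Phi_chargeProj (c : ℤ) (U : Fock) : Phi (chargeProj c U) = wProj c (Phi U) := by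
  refine bosonFock_ext fun l d => ?_
  rw [coeff_Phi_of_commute fun k => (J_commute_chargeProj k c).symm, coeff_wProj, bra_chargeProj]
  split_ifs <;> grind [coeff_Phi, MvPolynomial.coeff_zero]

end Phi

/-! ### Injectivity of `Φ` -/

section Injectivity

theorem Phi_eq_zero_of_mem {L : Submodule ℂ Fock} (hJ : ∀ k : ℕ+, ∀ V ∈ L, J k V ∈ L)
    (hbra : ∀ n, ∀ V ∈ L, bra n V = 0) {V : Fock} (hV : V ∈ L) : Phi V = 0 := by
  have hexp (d : ℕ+ →₀ ℕ) : expTimes d V ∈ L := by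
    refine coeff_formalExp_mem (fun _ => L) 0 (fun e _ W hW => ?_) d 0 hV
    exact coeff_JplusTimes_induction (p := fun _ A => A W ∈ L) (fun _ _ => zero_mem L)
      (fun k => hJ k W hW) e
  exact bosonFock_ext fun l d => by rw [coeff_Phi, hbra l _ (hexp d)]; rfl

theorem Phi_apply_eq_zero {K : Submodule ℂ Fock} (hK : ∀ k : ℕ+, ∀ V ∈ K, J k V ∈ K)
    {T : ℤ → Fock → Fock} {c : ℂ}
    (hT : ∀ (k : ℕ+) m V, J k (T m V) = T m (J k V) + c • T (m - k) V)
    (hbra : ∀ n m, ∀ V ∈ K, bra n (T m V) = 0) (m : ℤ) {V : Fock} (hV : V ∈ K) :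
    Phi (T m V) = 0 := by
  let L : Submodule ℂ Fock := Submodule.span ℂ {W | ∃ m, ∃ V ∈ K, T m V = W}
  have hmem {m : ℤ} {V : Fock} (hV : V ∈ K) : T m V ∈ L := Submodule.subset_span ⟨m, V, hV, rfl⟩
  have hJ (k : ℕ+) : L ≤ L.comap (J k) := by
    refine Submodule.span_le.2 ?_
    rintro _ ⟨m, V, hV, rfl⟩
    refine Submodule.mem_comap.2 ?_
    rw [hT]
    exact add_mem (hmem (hK k V hV)) (Submodule.smul_mem _ c (hmem hV))
  have hL (n : ℤ) : L ≤ LinearMap.ker (bra n) := by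
    refine Submodule.span_le.2 ?_
    rintro _ ⟨m, V, hV, rfl⟩
    exact hbra n m V hV
  exact Phi_eq_zero_of_mem (fun k _ h => hJ k h) (fun n _ h => hL n h) (hmem hV)

theorem J_psiField (k m : ℤ) (U : Fock) :
    J k (psiField U m) = psiField (J k U) m + (1 : ℂ) • psiField U (m - k) := by
  rw [one_smul, ← sub_eq_iff_eq_add']
  exact LinearMap.congr_fun (lie_J_psi k m) U

theorem J_psiStarField (k m : ℤ) (U : Fock) :
    J k (psiStarField U m) = psiStarField (J k U) m + (-1 : ℂ) • psiStarField U (m - k) := by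
  rw [neg_one_smul, ← sub_eq_iff_eq_add', psiStarField, psiStarField, psiStarField, neg_sub,
    sub_eq_neg_add k m]
  exact LinearMap.congr_fun (lie_J_psiStar k (-m)) U

theorem bra_eq_zero_of_Phi_eq_zero {V : Fock} (hV : Phi V = 0) (n : ℤ) : bra n V = 0 := by
  have hcoeff := coeff_Phi V n 0
  rw [hV, expTimes_zero] at hcoeff
  exact hcoeff.symm

theorem J_mem_ker_PhiHom (k : ℕ+) {V : Fock} (hV : V ∈ LinearMap.ker PhiHom) :
    J k V ∈ LinearMap.ker PhiHom := by
  change Phi (J k V) = 0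
  rw [Phi_J_pos, show Phi V = 0 from hV, map_zero]

theorem psiStar_mem_ker_PhiHom (m : ℤ) {V : Fock} (hV : V ∈ LinearMap.ker PhiHom) :
    psiStar m V ∈ LinearMap.ker PhiHom := by
  have hexp (j : ℕ) {W : Fock} (hW : W ∈ LinearMap.ker PhiHom) :
      PowerSeries.coeff j (formalExp Jplus) W ∈ LinearMap.ker PhiHom := by
    refine coeff_formalExp_mem_powerSeries (f := Jplus) (fun _ => LinearMap.ker PhiHom) 0
      (fun n _ W hW => ?_) j 0 hW
    refine coeff_xi_induction (p := fun _ (A : Module.End ℂ Fock) => A W ∈ LinearMap.ker PhiHom)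
      _ (zero_mem _) (fun k => ?_) n
    rw [LinearMap.smul_apply]
    exact Submodule.smul_mem _ _ (J_mem_ker_PhiHom k hW)
  have hfield := Phi_apply_eq_zero (T := fun m V => psiStarField V m)
    (fun k _ h => J_mem_ker_PhiHom k h) (fun k m V => J_psiStarField k m V)
    (fun n m W hW => ?_) (-m) hV
  · rwa [psiStarField, neg_neg] at hfield
  · rw [bra_psiStarField]
    exact atZ_induction (p := fun _ (A : Module.End ℂ Fock) => bra (n + 1) (A W) = 0)
      (fun _ _ => map_zero _) (fun j => bra_eq_zero_of_Phi_eq_zero (hexp j hW) (n + 1)) _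

theorem eq_zero_of_psiStar_mem {K : Submodule ℂ Fock} (hK : ∀ k, ∀ V ∈ K, psiStar k V ∈ K)
    (hbra : ∀ n, ∀ V ∈ K, bra n V = 0) {V : Fock} (hV : V ∈ K) : V = 0 := by
  have hcoord {a b : ℤ} (hab : a ≤ b) : ∀ S : Maya, Set.Iio a ⊆ S.1 → S.1 ⊆ Set.Iio b →
      ∀ V ∈ K, V S = 0 := by
    induction b, hab using Int.leInduction with
    | base =>
      intro S ha hb V hV
      rw [show S = Maya.vac a from Subtype.ext (hb.antisymm ha)]
      exact hbra a V hV
    | succ b hab ih =>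
      intro S ha hb V hV
      by_cases hbS : b ∈ S.1
      · have herase := ih (S.erase b) (fun x hx => ⟨ha hx, (lt_of_lt_of_le hx hab).ne⟩)
          (fun x hx => lt_of_le_of_ne (Int.le_of_lt_add_one (hb hx.1)) hx.2) (psiStar b V)
          (hK b V hV)
        rw [psiStar_apply, if_neg fun h => h.2 rfl, Maya.insert_erase hbS] at herase
        exact (mul_eq_zero.1 herase).resolve_left
          (left_ne_zero_of_mul_eq_one (Maya.sign_mul_self b _))
      · exact ih S ha (fun x hx => lt_of_le_of_ne (Int.le_of_lt_add_one (hb hx))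
          fun h => hbS (h ▸ hx)) V hV
  refine Finsupp.ext fun S => ?_
  obtain ⟨a, b, ha, hb⟩ := S.2
  exact hcoord (Set.Iio_subset_Iio_iff.1 (ha.trans hb)) S ha hb V hV

theorem PhiHom_injective : Function.Injective PhiHom :=
  (injective_iff_map_eq_zero PhiHom).2 fun _ hU =>
    eq_zero_of_psiStar_mem (fun k _ => psiStar_mem_ker_PhiHom k)
      (fun n _ hV => bra_eq_zero_of_Phi_eq_zero hV n) hU

end Injectivity

/-! ### Bosonization -/

section Bosonization

theorem pointwiseFinite_chargeProj : PointwiseFinite chargeProj := by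
  intro U
  refine (U.hasFiniteSupport.image Maya.charge).subset fun c hc => ?_
  obtain ⟨S, hS⟩ := Finsupp.ne_iff.1 hc
  rw [chargeProj_apply, Finsupp.zero_apply, ite_ne_right_iff] at hS
  exact ⟨S, hS.2, hS.1⟩

theorem pointwiseFinite_expP_zQ : PointwiseFinite expP_zQ := fun U =>
  (pointwiseFinite_chargeProj U).subset (Function.support_comp_subset (map_zero (expP 1)) _)

theorem pointwiseFinite_zQ_expP : PointwiseFinite zQ_expP := fun U =>
  (pointwiseFinite_chargeProj (expP (-1) U)).preimage neg_injective.injOn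

theorem J_commute_expP_zQ (k : ℕ+) (m : ℤ) : Commute (J k) (expP_zQ m) :=
  (J_commute_expP (by positivity) 1).mul_right (J_commute_chargeProj k m)

theorem J_commute_zQ_expP (k : ℕ+) (m : ℤ) : Commute (J k) (zQ_expP m) :=
  (J_commute_chargeProj k (-m)).mul_right (J_commute_expP (by positivity) (-1))

theorem commute_coeff_Jplus {x : Module.End ℂ Fock} (h : ∀ k : ℕ+, Commute x (J k)) (n : ℕ) :
    Commute x (PowerSeries.coeff n Jplus) :=
  coeff_xi_induction (p := fun _ A => Commute x A) _ (Commute.zero_right x)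
    (fun k => (h k).smul_right _) n

theorem commute_coeff_neg_Jplus {x : Module.End ℂ Fock} (h : ∀ k : ℕ+, Commute x (J k)) (n : ℕ) :
    Commute x (PowerSeries.coeff n (-Jplus)) := by
  rw [map_neg]
  exact (commute_coeff_Jplus h n).neg_right

theorem lie_J_coeff_Jminus (k : ℕ+) (n : ℕ) :
    ⁅J k, PowerSeries.coeff n Jminus⁆ = if n = k then (1 : ℂ) • (1 : Module.End ℂ Fock) else 0 := by
  refine coeff_xi_induction (p := fun n (A : Module.End ℂ Fock) =>
    ⁅J k, A⁆ = if n = (k : ℕ) then (1 : ℂ) • 1 else 0) _ ?_ (fun j => ?_) n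
  · rw [if_neg k.ne_zero.symm, Ring.lie_def, mul_zero, zero_mul, sub_zero]
  · have hjk : (k : ℤ) + -j = 0 ↔ (j : ℕ) = k := by omega
    rw [Ring.lie_def, mul_smul_comm, smul_mul_assoc, ← smul_sub, ← Ring.lie_def, lie_J_J,
      if_congr hjk rfl rfl, smul_ite, smul_zero, smul_smul]
    refine ite_congr rfl (fun h => ?_) fun _ => rfl
    rw [h, Int.cast_natCast, inv_mul_cancel₀ (Nat.cast_ne_zero.2 k.ne_zero)]

theorem lie_J_coeff_neg_Jminus (k : ℕ+) (n : ℕ) :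
    ⁅J k, PowerSeries.coeff n (-Jminus)⁆ =
      if n = k then (-1 : ℂ) • (1 : Module.End ℂ Fock) else 0 := by
  have hlie := congrArg Neg.neg (lie_J_coeff_Jminus k n)
  rw [Ring.lie_def] at hlie ⊢
  rw [map_neg, mul_neg, neg_mul, sub_neg_eq_add, neg_add_eq_sub, ← neg_sub, hlie]
  split_ifs <;> simp

theorem bra_coeff_Jminus (n : ℤ) (i : ℕ) (U : Fock) : bra n (PowerSeries.coeff i Jminus U) = 0 := by
  refine coeff_xi_induction (p := fun _ (A : Module.End ℂ Fock) => bra n (A U) = 0) _ (map_zero _)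
    (fun k => ?_) i
  rw [LinearMap.smul_apply, map_smul, bra_J_of_neg (by simp), smul_zero]

theorem bra_coeff_neg_Jminus (n : ℤ) (i : ℕ) (U : Fock) :
    bra n (PowerSeries.coeff i (-Jminus) U) = 0 := by
  rw [map_neg, LinearMap.neg_apply, map_neg, bra_coeff_Jminus, neg_zero]

theorem bra_prod₃ {f : PowerSeries (Module.End ℂ Fock)} {B C : ℤ → Module.End ℂ Fock}
    (hB : PointwiseFinite B) (hC : PointwiseFinite C)
    (hbra : ∀ n i U, bra n (PowerSeries.coeff i f U) = 0) (n : ℤ) (U : Fock) (m : ℤ) :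
    bra n (prod₃ (atZ (formalExp f)) B C U m) = ∑ᶠ a, bra n (B a (C (m - a) U)) := by
  have hbra_act (u : ℤ → Fock) (hu : (Function.support u).Finite) :
      bra n (act (atZ (formalExp f)) u m) = bra n (u m) := by
    rw [act, map_finsum _ (composable_of_support_finite _ hu m), finsum_eq_single _ 0]
    · rw [map_atZ_formalExp_of_map_coeff_eq_zero _ (hbra n), if_pos rfl, sub_zero]
    · intro a ha
      rw [map_atZ_formalExp_of_map_coeff_eq_zero _ (hbra n), if_neg ha]
  rw [prod₃_eq_act_act, hbra_act _ (hB.act_support_finite (hC U)), act,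
    map_finsum _ (composable_of_support_finite B (hC U) m)]

theorem eq_prod₃_of_bra {f : PowerSeries (Module.End ℂ Fock)} {B C : ℤ → Module.End ℂ Fock}
    {F : Fock → ℤ → Fock} {c : ℂ} (hB : PointwiseFinite B) (hC : PointwiseFinite C)
    (hJB : ∀ (k : ℕ+) m, Commute (J k) (B m)) (hJC : ∀ (k : ℕ+) m, Commute (J k) (C m))
    (h0 : PowerSeries.constantCoeff f = 0)
    (hJf : ∀ (k : ℕ+) n, ⁅J k, PowerSeries.coeff n f⁆ = if n = k then c • 1 else 0)
    (hbraf : ∀ n i U, bra n (PowerSeries.coeff i f U) = 0)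
    (hJF : ∀ (k : ℕ+) m U, J k (F U m) = F (J k U) m + c • F U (m - k))
    (hbraF : ∀ n m U, bra n (F U m) = ∑ᶠ a, bra n (B a (C (m - a) U))) (U : Fock) :
    F U = prod₃ (atZ (formalExp f)) B C U := by
  funext m
  refine sub_eq_zero.1 (PhiHom_injective ?_)
  rw [map_zero]
  refine Phi_apply_eq_zero (K := ⊤) (T := fun m V => F V m - prod₃ (atZ (formalExp f)) B C V m)
    (c := c) (fun _ _ _ => trivial) (fun k m V => ?_) (fun n m V _ => ?_) m trivial
  · rw [map_sub, hJF, apply_prod₃ hB hC (lie_atZ_formalExp h0 (hJf k)) (hJB k) (hJC k), smul_sub]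
    abel
  · rw [map_sub, hbraF, bra_prod₃ hB hC hbraf, sub_self]

theorem psiField_eq_expPhi (U : Fock) : psiField U = expPhi U := by
  refine eq_prod₃_of_bra pointwiseFinite_expP_zQ pointwiseFinite_atZInv_formalExp_neg_Jplus
    J_commute_expP_zQ (fun k => commute_atZInv_formalExp (f := -Jplus) <|
      commute_coeff_neg_Jplus fun j => J_commute (by positivity))
    (constantCoeff_xi _) lie_J_coeff_Jminus bra_coeff_Jminus (fun k m U => ?_)
    (fun n m U => ?_) U
  · exact J_psiField k m U
  · have hterm (a : ℤ) (V : Fock) :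
        bra n (expP_zQ a V) = if n - 1 = a then bra (n - 1) V else 0 := by
      rw [expP_zQ, Module.End.mul_apply, bra_expP, bra_chargeProj]
    rw [bra_psiField, finsum_eq_single _ (n - 1) fun a ha => by rw [hterm, if_neg ha.symm], hterm,
      if_pos rfl]

theorem psiStarField_eq_expNegPhi (U : Fock) : psiStarField U = expNegPhi U := by
  refine eq_prod₃_of_bra pointwiseFinite_zQ_expP pointwiseFinite_atZInv_formalExp_Jplus
    J_commute_zQ_expP (fun k => commute_atZInv_formalExp (f := Jplus) <|
      commute_coeff_Jplus fun j => J_commute (by positivity))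
    (by rw [map_neg, Jminus, constantCoeff_xi, neg_zero]) lie_J_coeff_neg_Jminus
    bra_coeff_neg_Jminus (fun k m U => ?_) (fun n m U => ?_) U
  · exact J_psiStarField k m U
  · have hterm (a : ℤ) (V : Fock) :
        bra n (zQ_expP a V) = if n = -a then bra (n + 1) V else 0 := by
      rw [zQ_expP, Module.End.mul_apply, bra_chargeProj, bra_expP, sub_neg_eq_add]
    rw [bra_psiStarField, finsum_eq_single _ (-n) fun a ha => by rw [hterm, if_neg (by omega)],
      hterm, if_pos (neg_neg n).symm, sub_neg_eq_add]

end Bosonization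

/-! ### Vertex operators -/

section VertexOperators

theorem J_ket_vac (k : ℕ+) (l : ℤ) : J k (ket (Maya.vac l)) = 0 := by
  rw [J_apply]
  refine finsum_eq_zero_of_forall_eq_zero fun j => ?_
  have hk := k.pos
  rw [normalOrdered_of_ne (by omega), Module.End.mul_apply]
  obtain h | h := lt_or_ge j l
  · exact psi_psiStar_ket_of_mem h (by omega)
  · rw [psiStar_ket_of_notMem (by rw [Maya.mem_vac]; omega), map_zero]

theorem expTimes_ket_vac {d : ℕ+ →₀ ℕ} (hd : d ≠ 0) (l : ℤ) :
    expTimes d (ket (Maya.vac l)) = 0 := by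
  obtain ⟨k, hk⟩ := Finsupp.ne_iff.1 hd
  have hle : Finsupp.single k 1 ≤ d := Finsupp.single_le_iff.2 (Nat.one_le_iff_ne_zero.2 hk)
  obtain ⟨e, rfl⟩ := exists_add_of_le hle
  have hcomm : Commute (J k) (expTimes e) := commute_expTimes (fun j => J_commute (by positivity)) e
  have hexp := LinearMap.congr_fun (expTimes_add_single e k) (ket (Maya.vac l))
  rw [hcomm.eq, Module.End.mul_apply, J_ket_vac, map_zero, LinearMap.smul_apply] at hexp
  rw [add_comm]
  exact (smul_eq_zero.1 hexp).resolve_left (by exact_mod_cast (e k).succ_ne_zero)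

theorem Phi_ket_vac (l : ℤ) : Phi (ket (Maya.vac l)) = LaurentPolynomial.T l := by
  classical
  refine bosonFock_ext fun j d => ?_
  rw [coeff_Phi, LaurentPolynomial.T_apply]
  obtain rfl | hd := eq_or_ne d 0
  · rw [expTimes_zero, Module.End.one_apply, bra_apply, ket_apply,
      if_congr Maya.vac_injective.eq_iff rfl rfl]
    split_ifs <;> simp
  · rw [expTimes_ket_vac hd, map_zero]
    split_ifs <;> simp [MvPolynomial.coeff_one, hd.symm]

theorem C_mul_T_mem {L : Submodule ℂ BosonFock} (hT : ∀ l, LaurentPolynomial.T l ∈ L)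
    (htime : ∀ (k : ℕ+), ∀ f ∈ L, time k * f ∈ L) (p : MvPolynomial ℕ+ ℂ) (l : ℤ) :
    LaurentPolynomial.C p * LaurentPolynomial.T l ∈ L := by
  induction p using MvPolynomial.induction_on with
  | C a =>
    have hscalar : (LaurentPolynomial.C (MvPolynomial.C a) * LaurentPolynomial.T l : BosonFock) =
        a • LaurentPolynomial.T l := by
      refine bosonFock_ext fun j d => ?_
      rw [coeff_C_mul_T, AddMonoidAlgebra.coeff_smul_apply, LaurentPolynomial.T_apply]
      split_ifs <;> simp [MvPolynomial.coeff_C, MvPolynomial.coeff_one]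
    rw [hscalar]
    exact Submodule.smul_mem _ _ (hT l)
  | add p q hp hq =>
    rw [map_add, add_mul]
    exact add_mem hp hq
  | mul_X p k hp =>
    rw [mul_comm p, map_mul, mul_assoc]
    exact htime k _ hp

theorem PhiHom_surjective : Function.Surjective PhiHom := by
  refine LinearMap.range_eq_top.1 (eq_top_iff.2 fun f _ => ?_)
  have hT (l : ℤ) : LaurentPolynomial.T l ∈ LinearMap.range PhiHom := ⟨_, Phi_ket_vac l⟩
  have htime (k : ℕ+) (g : BosonFock) (hg : g ∈ LinearMap.range PhiHom) :
      time k * g ∈ LinearMap.range PhiHom := by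
    obtain ⟨U, rfl⟩ := hg
    rw [← Submodule.smul_mem_iff _ (Nat.cast_ne_zero.2 k.ne_zero : (k : ℂ) ≠ 0)]
    exact ⟨J (-k) U, Phi_J_neg k U⟩
  induction f using LaurentPolynomial.induction_on' with
  | add f g hf hg => exact add_mem (hf trivial) (hg trivial)
  | C_mul_T l p => exact C_mul_T_mem hT htime p l

theorem PhiHom_coeff_Jminus (n : ℕ) (U : Fock) :
    PhiHom (PowerSeries.coeff n Jminus U) = PowerSeries.coeff n xiTime (PhiHom U) := by
  refine map_coeff_xi (fun k V => ?_) n U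
  have hJ : PhiHom (J (-k) V) = (k : ℂ) • mulTime k (PhiHom V) := Phi_J_neg k V
  rw [LinearMap.smul_apply, map_smul, hJ, smul_smul,
    inv_mul_cancel₀ (Nat.cast_ne_zero.2 k.ne_zero), one_smul]

theorem PhiHom_coeff_Jplus (n : ℕ) (U : Fock) :
    PhiHom (PowerSeries.coeff n Jplus U) = PowerSeries.coeff n xiD (PhiHom U) := by
  refine map_coeff_xi (fun k V => ?_) n U
  rw [LinearMap.smul_apply, map_smul]
  exact congrArg _ (Phi_J_pos k V)

theorem PhiHom_expP_zQ (m : ℤ) (U : Fock) : PhiHom (expP_zQ m U) = bExpP_zQ m (PhiHom U) :=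
  (Phi_expP 1 _).trans (congrArg _ (Phi_chargeProj m U))

theorem PhiHom_zQ_expP (m : ℤ) (U : Fock) : PhiHom (zQ_expP m U) = bzQ_expP m (PhiHom U) :=
  (Phi_chargeProj (-m) _).trans (congrArg _ (Phi_expP (-1) U))

theorem pointwiseFinite_bExpP_zQ : PointwiseFinite bExpP_zQ :=
  PointwiseFinite.of_surjective PhiHom_surjective PhiHom_expP_zQ pointwiseFinite_expP_zQ

theorem pointwiseFinite_bzQ_expP : PointwiseFinite bzQ_expP :=
  PointwiseFinite.of_surjective PhiHom_surjective PhiHom_zQ_expP pointwiseFinite_zQ_expP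

theorem pointwiseFinite_atZInv_formalExp_xiD : PointwiseFinite (atZInv (formalExp xiD)) :=
  PointwiseFinite.of_surjective PhiHom_surjective
    (fun m => map_atZ_formalExp (f := Jplus) PhiHom_coeff_Jplus (-m))
    pointwiseFinite_atZInv_formalExp_Jplus

theorem pointwiseFinite_atZInv_formalExp_neg_xiD : PointwiseFinite (atZInv (formalExp (-xiD))) :=
  PointwiseFinite.of_surjective PhiHom_surjective
    (fun m => map_atZ_formalExp (f := -Jplus) (map_coeff_neg PhiHom_coeff_Jplus) (-m))
    pointwiseFinite_atZInv_formalExp_neg_Jplus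

theorem Phi_psiField (U : Fock) : (fun m => Phi (psiField U m)) = vertexX (Phi U) := by
  rw [psiField_eq_expPhi]
  exact map_prod₃_swap PhiHom_surjective pointwiseFinite_expP_zQ
    pointwiseFinite_atZInv_formalExp_neg_Jplus
    (fun a => commute_atZInv_formalExp (f := -Jplus) <|
      commute_coeff_neg_Jplus fun k => (J_commute_expP_zQ k a).symm)
    (map_atZ_formalExp (f := Jminus) PhiHom_coeff_Jminus) PhiHom_expP_zQ
    (fun m => map_atZ_formalExp (f := -Jplus) (map_coeff_neg PhiHom_coeff_Jplus) (-m)) U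

theorem Phi_psiStarField (U : Fock) : (fun m => Phi (psiStarField U m)) = vertexXStar (Phi U) := by
  rw [psiStarField_eq_expNegPhi]
  exact map_prod₃_swap PhiHom_surjective pointwiseFinite_zQ_expP
    pointwiseFinite_atZInv_formalExp_Jplus
    (fun a => commute_atZInv_formalExp (f := Jplus) <|
      commute_coeff_Jplus fun k => (J_commute_zQ_expP k a).symm)
    (map_atZ_formalExp (f := -Jminus) (map_coeff_neg PhiHom_coeff_Jminus)) PhiHom_zQ_expP
    (fun m => map_atZ_formalExp (f := Jplus) PhiHom_coeff_Jplus (-m)) U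

end VertexOperators

end BosonFermion

end

open BosonFermion in
theorem mainTheorem4 :
    -- the sum defining `Φ` is finite: the coefficient of `w ^ l` in `Φ(U)` is `⟨l| e^{J_+(t)} |U⟩`
    (∀ (U : Fock) (l : ℤ), (((Phi U).coeff l : MvPolynomial ℕ+ ℂ) : MvPowerSeries ℕ+ ℂ) =
      amplitude l U) ∧
    -- the currents
    (∀ U : Fock,
      (∀ k : ℕ+, Phi (J k U) = dTime k (Phi U)) ∧
      Phi (J 0 U) = wdw (Phi U) ∧
      (∀ k : ℕ+, Phi (J (-k) U) = (k : ℂ) • (time k * Phi U))) ∧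
    -- the fermion fields are represented by the vertex operators, which are well defined
    WellDefined₃ (atZ (formalExp xiTime)) (atZInv (formalExp (-xiD))) bExpP_zQ ∧
    WellDefined₃ (atZ (formalExp (-xiTime))) (atZInv (formalExp xiD)) bzQ_expP ∧
    (∀ U : Fock,
      (fun m => Phi (psiField U m)) = vertexX (Phi U) ∧
      (fun m => Phi (psiStarField U m)) = vertexXStar (Phi U)) ∧
    -- the fermion fields as normally ordered exponentials of the bosonic field
    WellDefined₃ (atZ (formalExp Jminus)) expP_zQ (atZInv (formalExp (-Jplus))) ∧
    WellDefined₃ (atZ (formalExp (-Jminus))) zQ_expP (atZInv (formalExp Jplus)) ∧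
    (∀ U : Fock, psiField U = expPhi U ∧ psiStarField U = expNegPhi U) ∧
    -- the action on the left vacua: `⟨n| ψ(z) = z^{n-1} ⟨n-1| e^{-J_+([z⁻¹])}` and
    -- `⟨n| ψ*(z) = z^{-n} ⟨n+1| e^{J_+([z⁻¹])}`
    (∀ (n : ℤ) (U : Fock) (m : ℤ),
      bra n (psiField U m) = bra (n - 1) (atZInv (formalExp (-Jplus)) (m - (n - 1)) U) ∧
      bra n (psiStarField U m) = bra (n + 1) (atZInv (formalExp Jplus) (m + n) U)) := by
  exact ⟨coe_coeff_Phi, fun U => ⟨fun k => Phi_J_pos k U, Phi_J_zero U, fun k => Phi_J_neg k U⟩,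
    wellDefined₃_of_pointwiseFinite _ pointwiseFinite_atZInv_formalExp_neg_xiD
      pointwiseFinite_bExpP_zQ,
    wellDefined₃_of_pointwiseFinite _ pointwiseFinite_atZInv_formalExp_xiD
      pointwiseFinite_bzQ_expP,
    fun U => ⟨Phi_psiField U, Phi_psiStarField U⟩,
    wellDefined₃_of_pointwiseFinite _ pointwiseFinite_expP_zQ
      pointwiseFinite_atZInv_formalExp_neg_Jplus,
    wellDefined₃_of_pointwiseFinite _ pointwiseFinite_zQ_expP
      pointwiseFinite_atZInv_formalExp_Jplus,
    fun U => ⟨psiField_eq_expPhi U, psiStarField_eq_expNegPhi U⟩,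
    fun n U m => ⟨bra_psiField n m U, bra_psiStarField n m U⟩⟩
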